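/- An Ising model $(G,J,h)$ consists of a finite simple graph $G=(V,E)$, a symmetric matrix $J\in\mathbb R^{V\times V}$ with $J_{uv}\neq 0$ only if $\{u,v\}\in E$, and $h\in\mathbb R^V$. Its Gibbs distribution is $\mu(\sigma)=w(\sigma)/Z$ on $\sigma\in\{-1,+1\}^V$, where $w(\sigma)=\exp(\tfrac12\sigma^TJ\sigma+h^T\sigma)$ and $Z=\sum_\sigma w(\sigma)$. It is $b$-marginally bounded if for every $\Lambda\subseteq V$, every pinning $\tau\in\{-1,+1\}^\Lambda$, every $v\in V\setminus\Lambda$ and every $c\in\{-1,+1\}$, one has $\Pr_{\sigma\sim\mu}[\sigma_v=c\mid\sigma_\Lambda=\tau]\ge b$. For Gibbs distributions $\nu,\mu$ of two Ising models on the same graph let $D_f(\nu\|\mu)=\sum_\sigma\mu(\sigma)f(\nu(\sigma)/\mu(\sigma))$. Let $T^{\mathrm{sp}},T^{\mathrm{ct}}:\mathbb R_{>0}\to[|V|+|E|,\infty)$ be non-increasing. A sampling oracle with cost function $T^{\mathrm{sp}}$, given $\delta>0$, returns in time $T^{\mathrm{sp}}(\delta)$ a random configuration whose law is within total variation distance $\delta$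 of $\mu$. An approximate counting oracle with cost function $T^{\mathrm{ct}}$, given $\delta>0$, returns in time $T^{\mathrm{ct}}(\delta)$ a random real $\hat Z$ with $\Pr[e^{-\delta}Z\le\hat Z\le e^{\delta}Z]\ge 0.99$. Different calls use independent randomness. The oracles are polynomial-time, with polynomial $p$, if $T^{\mathrm{sp}}(\delta),T^{\mathrm{ct}}(\delta)\le p(|V|/\delta)$ for all $0<\delta<1$. Algorithms are randomized oracle programs on a real random access machine: finite programs, with integer constants only, that work with natural-number registers and arrays of reals, perform the operations $+,-,\times,\div,\exp,\ln$ and comparisons on reals in unit time each, toss fair coins, and call the oracles at the cost given by the cost functions. **Theorem.** Let $b>0$ be a constant and let $f$ be one of - $f(x)=x\ln x-x+1$ (Kullback–Leibler divergence), - $f(x)=-\ln x+x-1$ (Rényi divergence), - $f(x)=\tfrac12\bigl(x\ln x-(x+1)\ln\tfrac{x+1}{2}\bigr)$ (Jensen–Shannon divergence). There is a program $M$, depending only on $f$ and $b$, such that for every polynomial $p$ there is a polynomial $q$ in two variables for which the following holds. Let $(G,J^\nu,h^\nu)$ and $(G,J^\mu,h^\mu)$ be $b$-marginally bounded Ising models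 on a graph $G$ with $n$ vertices, each equipped with sampling and approximate counting oracles that are polynomial-time with polynomial $p$, and let $\varepsilon>0$. On input $(G,J^\nu,h^\nu,J^\mu,h^\mu,\varepsilon)$, with access to these four oracles, $M$ always halts within time $q(n,1/\varepsilon)$, and with probability at least $2/3$ it outputs a number $\hat D$ with $$e^{-\varepsilon}D_f(\nu\|\mu)\le\hat D\le e^{\varepsilon}D_f(\nu\|\mu).$$ -/

import Mathlib

open scoped Matrix

noncomputable section

namespace IsingDiv

/-! ### Ising models -/

/-- An Ising model on the graph `G`: a symmetric interaction matrix supported on the edges of `G`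
and a vector of external fields. -/
structure IsingModel {V : Type} (G : SimpleGraph V) where
  J : Matrix V V ℝ
  h : V → ℝ
  symm : J.IsSymm
  supp : ∀ u v, J u v ≠ 0 → G.Adj u v

/-- Spin configurations; `ℤˣ = {1, -1}`. -/
abbrev Config (V : Type) : Type := V → ℤˣ

/-- The configuration as a real vector with entries `±1`. -/
def spin {V : Type} (σ : Config V) : V → ℝ := fun v => ((σ v : ℤ) : ℝ)

namespace IsingModel

variable {V : Type} [Fintype V] [DecidableEq V] {G : SimpleGraph V}

/-- The weight `exp (σᵀ J σ / 2 + hᵀ σ)`. -/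
def weight (I : IsingModel G) (σ : Config V) : ℝ :=
  Real.exp (1 / 2 * (spin σ ⬝ᵥ (I.J *ᵥ spin σ)) + I.h ⬝ᵥ spin σ)

/-- The partition function. -/
def Z (I : IsingModel G) : ℝ := ∑ σ : Config V, I.weight σ

/-- The Gibbs distribution (its probability mass function). -/
def gibbs (I : IsingModel G) (σ : Config V) : ℝ := I.weight σ / I.Z

open Classical in
/-- The Gibbs probability of an event. -/
def prob (I : IsingModel G) (A : Config V → Prop) : ℝ := ∑ σ : Config V, if A σ then I.gibbs σ else 0

/-- The `b`-marginal lower bound: given any pinning `τ` of the vertices in `Λ`, the conditional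
probability that `v ∉ Λ` has spin `c` is at least `b`. -/
def MarginallyBounded (I : IsingModel G) (b : ℝ) : Prop :=
  ∀ (Λ : Finset V) (τ : Config V) (v : V) (c : ℤˣ), v ∉ Λ →
    b ≤ I.prob (fun σ => σ v = c ∧ ∀ u ∈ Λ, σ u = τ u) / I.prob (fun σ => ∀ u ∈ Λ, σ u = τ u)

/-- The `f`-divergence of (the Gibbs distribution of) `ν` from that of `μ`. -/
def fDiv (ν μ : IsingModel G) (f : ℝ → ℝ) : ℝ :=
  ∑ σ : Config V, μ.gibbs σ * f (ν.gibbs σ / μ.gibbs σ)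

end IsingModel

/-- Kullback–Leibler divergence. -/
def klGen (x : ℝ) : ℝ := x * Real.log x - x + 1

/-- Rényi divergence. -/
def renyiGen (x : ℝ) : ℝ := -Real.log x + x - 1

/-- Jensen–Shannon divergence. -/
def jsGen (x : ℝ) : ℝ := 1 / 2 * (x * Real.log x - (x + 1) * Real.log ((x + 1) / 2))

/-! ### Sampling and approximate counting oracles

An oracle is a randomized procedure: asked with error bound `ε` it consumes a random seed `ξ` with
law `P` and answers `out ε ξ`, at cost `cost ε`. Nothing is promised for `ε ≤ 0`. -/

/-- `T : ℝ_{>0} → [|V| + |E|, ∞)` is non-increasing. -/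
structure IsCostFunction {V : Type} (G : SimpleGraph V) (T : ℝ → ℝ) : Prop where
  ge_size : ∀ ε, 0 < ε → (Nat.card V : ℝ) + (Nat.card G.edgeSet : ℝ) ≤ T ε
  antitone : AntitoneOn T (Set.Ioi 0)

structure SamplingOracle {V : Type} [Fintype V] [DecidableEq V] {G : SimpleGraph V}
    (I : IsingModel G) {Ξ : Type} [MeasurableSpace Ξ] (P : MeasureTheory.Measure Ξ) where
  out : ℝ → Ξ → Config V
  cost : ℝ → ℝ
  isCost : IsCostFunction G cost
  measurable : ∀ ε, 0 < ε → ∀ σ, MeasurableSet {ξ | out ε ξ = σ}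
  /-- The law of the answer is within total variation distance `ε` of the Gibbs distribution. -/
  tv_le : ∀ ε, 0 < ε → 1 / 2 * ∑ σ : Config V, |P.real {ξ | out ε ξ = σ} - I.gibbs σ| ≤ ε

structure CountingOracle {V : Type} [Fintype V] [DecidableEq V] {G : SimpleGraph V}
    (I : IsingModel G) {Ξ : Type} [MeasurableSpace Ξ] (P : MeasureTheory.Measure Ξ) where
  out : ℝ → Ξ → ℝ
  cost : ℝ → ℝ
  isCost : IsCostFunction G cost
  measurable : ∀ ε, 0 < ε → Measurable (out ε)
  accurate : ∀ ε, 0 < ε →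
    0.99 ≤ P.real {ξ | Real.exp (-ε) * I.Z ≤ out ε ξ ∧ out ε ξ ≤ Real.exp ε * I.Z}

/-- The cost function is bounded by the polynomial `p` in `|V| / ε`, for `0 < ε < 1`. -/
def PolyBounded (V : Type) (p : Polynomial ℝ) (T : ℝ → ℝ) : Prop :=
  ∀ ε, 0 < ε → ε < 1 → T ε ≤ p.eval ((Nat.card V : ℝ) / ε)

/-- The first (`ν`) or the second (`μ`) input model. -/
inductive Which
  | first
  | second

/-- Sampling and approximate counting oracles for both input models. The seeds of the four oracles
live on one probability space; every call will get a fresh seed. -/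
structure Oracles {V : Type} [Fintype V] [DecidableEq V] {G : SimpleGraph V}
    (ν μ : IsingModel G) {Ξ : Type} [MeasurableSpace Ξ] (P : MeasureTheory.Measure Ξ) where
  sampleFirst : SamplingOracle ν P
  sampleSecond : SamplingOracle μ P
  countFirst : CountingOracle ν P
  countSecond : CountingOracle μ P

namespace Oracles

variable {V : Type} [Fintype V] [DecidableEq V] {G : SimpleGraph V} {ν μ : IsingModel G}
  {Ξ : Type} [MeasurableSpace Ξ] {P : MeasureTheory.Measure Ξ}

def sample (O : Oracles ν μ P) : Which → ℝ → Ξ → Config V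
  | .first => O.sampleFirst.out
  | .second => O.sampleSecond.out

def sampleCost (O : Oracles ν μ P) : Which → ℝ → ℝ
  | .first => O.sampleFirst.cost
  | .second => O.sampleSecond.cost

def count (O : Oracles ν μ P) : Which → ℝ → Ξ → ℝ
  | .first => O.countFirst.out
  | .second => O.countSecond.out

def countCost (O : Oracles ν μ P) : Which → ℝ → ℝ
  | .first => O.countFirst.cost
  | .second => O.countSecond.cost

/-- All four oracles run in time `p (|V| / ε)`. -/
def PolyTime (O : Oracles ν μ P) (p : Polynomial ℝ) : Prop :=
  ∀ i, PolyBounded V p (O.sampleCost i) ∧ PolyBounded V p (O.countCost i)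

end Oracles

/-! ### The machine model: randomized oracle programs over a real random access machine

A program is a finite command of a while-language. It has natural-number registers, two-dimensional
arrays of reals addressed by natural-number expressions, real arithmetic (with `exp` and `log`, and
integer constants only, without rounding), fair coins, and calls to the oracles. Every operation
takes unit time, an oracle call takes the time given by the cost function of the oracle. -/

/-- Natural-number expressions (`sub` is truncated). -/
inductive NExp
  | lit (k : ℕ)
  | reg (x : ℕ)
  | add (a b : NExp)
  | sub (a b : NExp)

/-- Real expressions; `get a i j` is the entry `(i, j)` of array number `a`. -/
inductive RExp
  | lit (k : ℤ)
  | ofNat (e : NExp)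
  | get (a : ℕ) (i j : NExp)
  | add (x y : RExp)
  | sub (x y : RExp)
  | mul (x y : RExp)
  | div (x y : RExp)
  | exp (x : RExp)
  | log (x : RExp)

/-- Tests. -/
inductive BExp
  | nlt (a b : NExp)
  | rlt (x y : RExp)
  | not (c : BExp)
  | and (c d : BExp)

/-- Commands. -/
inductive Cmd
  | skip
  /-- `x := e` -/
  | setN (x : ℕ) (e : NExp)
  /-- `a[i, j] := e` -/
  | setR (a : ℕ) (i j : NExp) (e : RExp)
  /-- set register `x` to a fair random bit -/
  | coin (x : ℕ)
  /-- call the sampling oracle of model `w` with error bound `e`; write spin `v` to `a[v, 0]` -/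
  | sample (w : Which) (e : RExp) (a : ℕ)
  /-- call the counting oracle of model `w` with error bound `e`; write the answer to `a[0, 0]` -/
  | count (w : Which) (e : RExp) (a : ℕ)
  | seq (c d : Cmd)
  | ite (t : BExp) (c d : Cmd)
  | loop (t : BExp) (c : Cmd)

/-- The memory, with the number of random draws (coins and oracle calls) made so far. -/
structure State where
  nat : ℕ → ℕ
  real : ℕ → ℕ → ℕ → ℝ
  draws : ℕ

def NExp.eval (s : State) : NExp → ℕ
  | .lit k => k
  | .reg x => s.nat x
  | .add a b => a.eval s + b.eval s
  | .sub a b => a.eval s - b.eval s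

/-- Division and logarithm are total, with the usual conventions (`x / 0 = 0`, `log 0 = 0`,
`log (-x) = log x`). -/
def RExp.eval (s : State) : RExp → ℝ
  | .lit k => (k : ℝ)
  | .ofNat e => (e.eval s : ℝ)
  | .get a i j => s.real a (i.eval s) (j.eval s)
  | .add x y => x.eval s + y.eval s
  | .sub x y => x.eval s - y.eval s
  | .mul x y => x.eval s * y.eval s
  | .div x y => x.eval s / y.eval s
  | .exp x => Real.exp (x.eval s)
  | .log x => Real.log (x.eval s)

def BExp.eval (s : State) : BExp → Prop
  | .nlt a b => a.eval s < b.eval s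
  | .rlt x y => x.eval s < y.eval s
  | .not c => ¬ c.eval s
  | .and c d => c.eval s ∧ d.eval s

/-- Time to evaluate an expression: its number of nodes. -/
def NExp.size : NExp → ℕ
  | .lit _ => 1
  | .reg _ => 1
  | .add a b => a.size + b.size + 1
  | .sub a b => a.size + b.size + 1

def RExp.size : RExp → ℕ
  | .lit _ => 1
  | .ofNat e => e.size + 1
  | .get _ i j => i.size + j.size + 1
  | .add x y => x.size + y.size + 1
  | .sub x y => x.size + y.size + 1
  | .mul x y => x.size + y.size + 1
  | .div x y => x.size + y.size + 1
  | .exp x => x.size + 1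
  | .log x => x.size + 1

def BExp.size : BExp → ℕ
  | .nlt a b => a.size + b.size + 1
  | .rlt x y => x.size + y.size + 1
  | .not c => c.size + 1
  | .and c d => c.size + d.size + 1

namespace State

def setN (s : State) (x k : ℕ) : State := { s with nat := Function.update s.nat x k }

def setR (s : State) (a i j : ℕ) (r : ℝ) : State :=
  { s with real := fun a' i' j' => if a' = a ∧ i' = i ∧ j' = j then r else s.real a' i' j' }

/-- Write a configuration into column `0` of array `a`. -/
def setConfig (s : State) (a : ℕ) {n : ℕ} (σ : Config (Fin n)) : State :=
  { s with real := fun a' i' j' =>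
      if h : a' = a ∧ i' < n ∧ j' = 0 then spin σ ⟨i', h.2.1⟩ else s.real a' i' j' }

def draw (s : State) : State := { s with draws := s.draws + 1 }

end State

/-- Big-step semantics. `Exec O ω c s t s'`: with oracles `O` and random source `ω`, the command `c`
started in `s` halts after time `t` in `s'`. The `k`-th random draw uses the seed `(ω k).1` (oracle
calls) or the bit `(ω k).2` (coins). The execution is determined by `O`, `ω`, `c` and `s`. -/
inductive Exec {n : ℕ} {G : SimpleGraph (Fin n)} {ν μ : IsingModel G} {Ξ : Type}
    [MeasurableSpace Ξ] {P : MeasureTheory.Measure Ξ} (O : Oracles ν μ P) (ω : ℕ → Ξ × Bool) :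
    Cmd → State → ℝ → State → Prop
  | skip (s : State) : Exec O ω .skip s 1 s
  | setN (s : State) (x : ℕ) (e : NExp) :
      Exec O ω (.setN x e) s (1 + e.size) (s.setN x (e.eval s))
  | setR (s : State) (a : ℕ) (i j : NExp) (e : RExp) :
      Exec O ω (.setR a i j e) s (1 + i.size + j.size + e.size)
        (s.setR a (i.eval s) (j.eval s) (e.eval s))
  | coin (s : State) (x : ℕ) :
      Exec O ω (.coin x) s 1 ((s.setN x (if (ω s.draws).2 then 1 else 0)).draw)
  | sample (s : State) (w : Which) (e : RExp) (a : ℕ) :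
      Exec O ω (.sample w e a) s (1 + e.size + O.sampleCost w (e.eval s))
        ((s.setConfig a (O.sample w (e.eval s) (ω s.draws).1)).draw)
  | count (s : State) (w : Which) (e : RExp) (a : ℕ) :
      Exec O ω (.count w e a) s (1 + e.size + O.countCost w (e.eval s))
        ((s.setR a 0 0 (O.count w (e.eval s) (ω s.draws).1)).draw)
  | seq {c d : Cmd} {s s' s'' : State} {t t' : ℝ} :
      Exec O ω c s t s' → Exec O ω d s' t' s'' → Exec O ω (.seq c d) s (t + t') s''
  | ite_true {b : BExp} {c d : Cmd} {s s' : State} {t : ℝ} :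
      b.eval s → Exec O ω c s t s' → Exec O ω (.ite b c d) s (1 + b.size + t) s'
  | ite_false {b : BExp} {c d : Cmd} {s s' : State} {t : ℝ} :
      ¬ b.eval s → Exec O ω d s t s' → Exec O ω (.ite b c d) s (1 + b.size + t) s'
  | loop_true {b : BExp} {c : Cmd} {s s' s'' : State} {t t' : ℝ} :
      b.eval s → Exec O ω c s t s' → Exec O ω (.loop b c) s' t' s'' →
        Exec O ω (.loop b c) s (1 + b.size + t + t') s''
  | loop_false {b : BExp} {c : Cmd} {s : State} :
      ¬ b.eval s → Exec O ω (.loop b c) s (1 + b.size) s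

open Classical in
/-- The input: `n` in register `0`, and the adjacency matrix of `G`, `J^ν`, `h^ν`, `J^μ`, `h^μ`
and `ε` in the arrays `0`, …, `5`. Everything else is `0`. -/
def inputState {n : ℕ} {G : SimpleGraph (Fin n)} (ν μ : IsingModel G) (ε : ℝ) : State where
  nat := fun x => if x = 0 then n else 0
  real := fun a i j =>
    if hi : i < n then
      if hj : j < n then
        if a = 0 then (if G.Adj ⟨i, hi⟩ ⟨j, hj⟩ then 1 else 0)
        else if a = 1 then ν.J ⟨i, hi⟩ ⟨j, hj⟩
        else if a = 2 ∧ j = 0 then ν.h ⟨i, hi⟩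
        else if a = 3 then μ.J ⟨i, hi⟩ ⟨j, hj⟩
        else if a = 4 ∧ j = 0 then μ.h ⟨i, hi⟩
        else if a = 5 ∧ i = 0 ∧ j = 0 then ε
        else 0
      else 0
    else if a = 5 ∧ i = 0 ∧ j = 0 then ε
    else 0
  draws := 0

/-- The output is the entry `(0, 0)` of array `6`. -/
def State.output (s : State) : ℝ := s.real 6 0 0

/-- The law of the random source: independent draws, each a fresh oracle seed with law `P` and an
independent fair bit. -/
def sourceLaw {Ξ : Type} [MeasurableSpace Ξ] (P : MeasureTheory.Measure Ξ)
    [MeasureTheory.IsProbabilityMeasure P] : MeasureTheory.Measure (ℕ → Ξ × Bool) :=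
  MeasureTheory.Measure.infinitePi
    (fun _ : ℕ => P.prod (PMF.uniformOfFintype Bool).toMeasure)

/-- `M` is an FPRAS for the `f`-divergence between two `b`-marginally bounded Ising models with
polynomial-time sampling and approximate counting oracles: on all such inputs it always halts in
time polynomial in `n` and `1 / ε`, and with probability at least `2 / 3` its output is within
relative error `e^{±ε}` (the complementary event has outer measure at most `1 / 3`). -/
def IsFPRAS (M : Cmd) (f : ℝ → ℝ) (b : ℝ) : Prop :=
  ∀ p : Polynomial ℝ, ∃ q : MvPolynomial (Fin 2) ℝ,
    ∀ (n : ℕ) (G : SimpleGraph (Fin n)) (ν μ : IsingModel G),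
      ν.MarginallyBounded b → μ.MarginallyBounded b →
    ∀ (Ξ : Type) [MeasurableSpace Ξ] (P : MeasureTheory.Measure Ξ)
      [MeasureTheory.IsProbabilityMeasure P] (O : Oracles ν μ P), O.PolyTime p →
    ∀ ε : ℝ, 0 < ε →
      (∀ ω : ℕ → Ξ × Bool, ∃ (t : ℝ) (s : State), Exec O ω M (inputState ν μ ε) t s ∧
        t ≤ MvPolynomial.eval ![(n : ℝ), 1 / ε] q) ∧
      sourceLaw P {ω | ¬ ∃ (t : ℝ) (s : State), Exec O ω M (inputState ν μ ε) t s ∧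
        Real.exp (-ε) * ν.fDiv μ f ≤ s.output ∧ s.output ≤ Real.exp ε * ν.fDiv μ f} ≤ 1 / 3

end IsingDiv

end

/-!
Write `f (exp t)` for a generator `f` at a likelihood ratio `exp t`. For the three generators this
function is `t ^ 2 / k` up to a cubic error near `0`, it is at least of order `min 1 (t ^ 2)`
everywhere, and up to a multiple of `exp t - 1` it equals `exp t * a t + c t` with `a` and `c`
`1`-Lipschitz (`IsLogGenerator`). With `l = log (ν / μ)`, which is the difference of the two
energies minus the constant `log (ν.Z / μ.Z)`, the divergence is therefore both the `μ`-mean of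
`f (exp l)` and the sum of the `ν`-mean of `a l` and the `μ`-mean of `c l`.

The divergence can be arbitrarily small, so an additive approximation is not enough. The key is a
lower bound: by marginal boundedness, reversing one spin changes a Gibbs weight by at most a
constant factor, and reversing two spins one after the other isolates a single parameter of the
energy difference. Hence the energy difference deviates from every constant by an amount controlled
by the sum `Q` of the squared parameter differences (`FlipBounded.mean_energy_ge`), and the
divergence is at least `min 1 (Q / n ^ 4)` up to a constant.

If `Q` is at least an inverse polynomial in `n` and `1 / ε`, so is the divergence, and an additive
approximation suffices: estimate `log ν.Z` and `log μ.Z` by the counting oracles and average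
`a l` and `c l` over samples (`abs_direct_estimate_sub_fDiv_le`). If `Q` is smaller, the counting
oracles are too coarse, but then `l` is so small that the divergence is `1 / k` times the variance
of the energy difference up to a small relative error. The variance does not involve the partition
functions; it is at least an inverse polynomial multiple of the maximum of the squared energy
difference, so that the empirical variance of polynomially many samples has small relative error
(`abs_moment_estimate_sub_fDiv_le`). Chebyshev's inequality for independent seeds controls all
empirical means (`SamplingOracle.measure_empirical_mean_le`).

The program computes both estimates and selects one by comparing `Q` with the threshold. Its
control flow does not depend on the answers of the oracles, so it always halts in the same
polynomial time, and its output is an explicit function of the random source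
(`halts_divergenceProgram`).
-/

/-! ### The three generators in logarithmic scale -/

namespace IsingDiv

open Real

/-- The generator `f` in the variable `t = log x`: on `exp t` it is, up to a multiple of
`exp t - 1` (which integrates to zero), a combination `exp t * a t + c t` of `1`-Lipschitz
functions; it is `t ^ 2 / k` up to a cubic error near `0`, and at least of order `min 1 (t ^ 2)`
everywhere. -/
structure IsLogGenerator (f a c : ℝ → ℝ) (k : ℕ) : Prop where
  one_le : 1 ≤ k
  le_eight : k ≤ 8
  decomp : ∃ β : ℝ, ∀ t, f (exp t) = exp t * a t + c t + β * (exp t - 1)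
  a_zero : a 0 = 0
  c_zero : c 0 = 0
  a_lip : ∀ s t, |a s - a t| ≤ |s - t|
  c_lip : ∀ s t, |c s - c t| ≤ |s - t|
  cubic : ∀ t, |t| ≤ 1 / 4 → |f (exp t) - t ^ 2 / k| ≤ 2 * |t| ^ 3
  lower : ∀ t, min 1 (t ^ 2) / 80 ≤ f (exp t)

lemma klGen_exp (t : ℝ) : klGen (exp t) = exp t * t - exp t + 1 := by
  simp [klGen]

lemma renyiGen_exp (t : ℝ) : renyiGen (exp t) = exp t - 1 - t := by
  simp [renyiGen]; ring

lemma abs_exp_sub_quadratic_le {t : ℝ} (ht : |t| ≤ 1) :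
    |exp t - (1 + t + t ^ 2 / 2)| ≤ 2 / 9 * |t| ^ 3 := by
  have h := Real.exp_bound ht (n := 3) (by norm_num)
  simp [Finset.sum_range_succ, Nat.factorial] at h
  norm_num at h
  linarith

lemma klGen_exp_cubic {t : ℝ} (ht : |t| ≤ 1 / 4) :
    |klGen (exp t) - t ^ 2 / 2| ≤ |t| ^ 3 := by
  have h := abs_exp_sub_quadratic_le (ht.trans (by norm_num))
  set r := exp t - (1 + t + t ^ 2 / 2) with hr
  have he : exp t = 1 + t + t ^ 2 / 2 + r := by rw [hr]; ring
  rw [klGen_exp, he]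
  have h1 : (1 + t + t ^ 2 / 2 + r) * t - (1 + t + t ^ 2 / 2 + r) + 1 - t ^ 2 / 2
      = t ^ 3 / 2 + (t - 1) * r := by ring
  rw [h1]
  have h2 : |t - 1| ≤ 5 / 4 := by
    rw [abs_le] at ht ⊢; constructor <;> linarith [ht.1, ht.2]
  have h3 : |(t - 1) * r| ≤ 5 / 4 * (2 / 9 * |t| ^ 3) := by
    rw [abs_mul]; gcongr
  have h4 : |t ^ 3 / 2| = |t| ^ 3 / 2 := by rw [abs_div, abs_pow]; norm_num
  have h5 : 0 ≤ |t| ^ 3 := by positivity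
  calc |t ^ 3 / 2 + (t - 1) * r| ≤ |t ^ 3 / 2| + |(t - 1) * r| := abs_add_le _ _
    _ ≤ |t| ^ 3 := by rw [h4]; linarith

lemma renyiGen_exp_cubic {t : ℝ} (ht : |t| ≤ 1 / 4) :
    |renyiGen (exp t) - t ^ 2 / 2| ≤ |t| ^ 3 := by
  have h := abs_exp_sub_quadratic_le (ht.trans (by norm_num))
  have h5 : 0 ≤ |t| ^ 3 := by positivity
  rw [renyiGen_exp, show exp t - 1 - t - t ^ 2 / 2 = exp t - (1 + t + t ^ 2 / 2) by ring]
  linarith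

lemma renyiGen_exp_lower (t : ℝ) : min 1 (t ^ 2) / 4 ≤ renyiGen (exp t) := by
  rw [renyiGen_exp]
  have hm1 := min_le_left 1 (t ^ 2)
  have hm2 := min_le_right 1 (t ^ 2)
  rcases le_total t (-2) with h | h
  · have := exp_pos t
    linarith
  · have h1 : 1 + t / 2 ≤ exp (t / 2) := by linarith [add_one_le_exp (t / 2)]
    have h2 : exp t = exp (t / 2) ^ 2 := by rw [← exp_nat_mul]; congr 1; push_cast; ring
    have h3 : (1 + t / 2) ^ 2 ≤ exp (t / 2) ^ 2 := by
      apply pow_le_pow_left₀ (by linarith) h1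
    rw [h2]; nlinarith

lemma klGen_exp_lower (t : ℝ) : min 1 (t ^ 2) / 5 ≤ klGen (exp t) := by
  have hm1 := min_le_left 1 (t ^ 2)
  have hm2 := min_le_right 1 (t ^ 2)
  have hm0 : 0 ≤ min 1 (t ^ 2) := le_min zero_le_one (sq_nonneg t)
  have he : klGen (exp t) = exp t * renyiGen (exp (-t)) := by
    have : exp t * exp (-t) = 1 := by rw [← exp_add]; simp
    rw [klGen_exp, renyiGen_exp]; linear_combination -this
  rcases le_total 0 t with h | h
  · have h1 := renyiGen_exp_lower (-t)
    have h2 := one_le_exp h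
    rw [neg_sq] at h1
    rw [he]; nlinarith
  · obtain ⟨s, rfl⟩ : ∃ s, t = -s := ⟨-t, by simp⟩
    have hs : 0 ≤ s := by linarith
    have h1 := quadratic_le_exp_of_nonneg hs
    have h2 : 0 < 1 + s + s ^ 2 / 2 := by positivity
    have h3 : exp (-s) ≤ 1 / (1 + s + s ^ 2 / 2) := by
      rw [exp_neg, inv_eq_one_div]; exact one_div_le_one_div_of_le h2 h1
    have h4 : (1 + s) * exp (-s) ≤ (1 + s) * (1 / (1 + s + s ^ 2 / 2)) := by gcongr
    have h5 : (1 + s) * (1 / (1 + s + s ^ 2 / 2)) ≤ 1 - min 1 ((-s) ^ 2) / 5 := by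
      rw [mul_one_div, div_le_iff₀ h2]
      rcases le_total s 1 with h6 | h6 <;> nlinarith
    rw [klGen_exp]; linarith

/-- Second-order expansion of the Kullback-Leibler generator at `1`. -/
lemma abs_klGen_one_sub_le {u : ℝ} (hu : |u| ≤ 1 / 2) :
    |klGen (1 - u) - u ^ 2 / 2| ≤ 4 * |u| ^ 3 := by
  have h := abs_log_sub_add_sum_range_le (x := u) (by linarith) 2
  simp [Finset.sum_range_succ] at h
  norm_num at h
  set r := u + u ^ 2 / 2 + log (1 - u) with hr
  have hl : log (1 - u) = r - u - u ^ 2 / 2 := by rw [hr]; ring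
  have h0 : 0 ≤ |u| ^ 3 := by positivity
  have h1 : |r| ≤ 2 * |u| ^ 3 := by
    refine h.trans ?_
    rw [div_le_iff₀ (by linarith)]
    nlinarith
  rw [klGen, hl, show (1 - u) * (r - u - u ^ 2 / 2) - (1 - u) + 1 - u ^ 2 / 2
    = u ^ 3 / 2 + (1 - u) * r by ring]
  have h2 : |1 - u| ≤ 3 / 2 := by
    rw [abs_le] at hu ⊢; constructor <;> linarith [hu.1, hu.2]
  have h3 : |(1 - u) * r| ≤ 3 / 2 * (2 * |u| ^ 3) := by rw [abs_mul]; gcongr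
  have h4 : |u ^ 3 / 2| = |u| ^ 3 / 2 := by rw [abs_div, abs_pow]; norm_num
  calc |u ^ 3 / 2 + (1 - u) * r| ≤ |u ^ 3 / 2| + |(1 - u) * r| := abs_add_le _ _
    _ ≤ 4 * |u| ^ 3 := by rw [h4]; linarith

lemma jsGen_eq_klGen (x : ℝ) : jsGen x = 1 / 2 * (klGen x - 2 * klGen ((x + 1) / 2)) := by
  simp only [jsGen, klGen]; ring

lemma jsGen_exp_cubic {t : ℝ} (ht : |t| ≤ 1 / 4) :
    |jsGen (exp t) - t ^ 2 / 8| ≤ 2 * |t| ^ 3 := by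
  have hk := klGen_exp_cubic ht
  have h1 := abs_exp_sub_one_sub_id_le (ht.trans (by norm_num))
  set q := exp t - 1 - t with hq
  have hu : (exp t + 1) / 2 = 1 - (-(t + q) / 2) := by rw [hq]; ring
  set u := -(t + q) / 2 with hudef
  have htn := abs_nonneg t
  have hq2 : |q| ≤ |t| ^ 2 := by rwa [sq_abs]
  have hun : |u| ≤ 5 / 8 * |t| := by
    rw [hudef, abs_div, abs_neg, abs_two]
    have := abs_add_le t q
    nlinarith
  have hc := abs_klGen_one_sub_le (u := u) (by linarith)
  have hu3 : |u| ^ 3 ≤ (5 / 8 * |t|) ^ 3 := pow_le_pow_left₀ (abs_nonneg _) hun 3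
  have hu2 : |u ^ 2 - t ^ 2 / 4| ≤ 9 / 16 * |t| ^ 3 := by
    rw [hudef, show (-(t + q) / 2) ^ 2 - t ^ 2 / 4 = (2 * t + q) * q / 4 by ring, abs_div,
      abs_mul, abs_of_pos (show (0 : ℝ) < 4 by norm_num)]
    have h2 : |2 * t + q| ≤ 9 / 4 * |t| := by
      have := abs_add_le (2 * t) q
      rw [abs_mul, abs_two] at this
      nlinarith
    have : |2 * t + q| * |q| ≤ 9 / 4 * |t| * |t| ^ 2 := by gcongr
    linarith
  rw [jsGen_eq_klGen, hu]
  have h3 : 0 ≤ |t| ^ 3 := by positivity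
  have e : 1 / 2 * (klGen (exp t) - 2 * klGen (1 - u)) - t ^ 2 / 8
      = 1 / 2 * (klGen (exp t) - t ^ 2 / 2) + (-(klGen (1 - u) - u ^ 2 / 2))
        + (-(1 / 2 * (u ^ 2 - t ^ 2 / 4))) := by ring
  rw [e]
  refine (abs_add_three _ _ _).trans ?_
  rw [abs_neg, abs_neg, abs_mul, abs_mul, abs_of_pos (show (0 : ℝ) < 1 / 2 by norm_num)]
  have : (5 / 8 * |t|) ^ 3 = 125 / 512 * |t| ^ 3 := by ring
  linarith

/-- The Jensen-Shannon generator is the average of two Kullback-Leibler generators relative to the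
midpoint `y = (x + 1) / 2`; one of `log (x / y)` and `log (1 / y)` is at least half of `log x`. -/
lemma jsGen_exp_lower (t : ℝ) : min 1 (t ^ 2) / 80 ≤ jsGen (exp t) := by
  set y := (exp t + 1) / 2 with hy
  have hx := exp_pos t
  have hy0 : 1 / 2 ≤ y := by rw [hy]; linarith
  have hy1 : 0 < y := by linarith
  have e : jsGen (exp t)
      = y / 2 * (klGen (exp (t - log y)) + klGen (exp (-log y))) := by
    rw [klGen_exp, klGen_exp, exp_sub, exp_neg, exp_log hy1, jsGen, ← hy, log_exp]
    have : exp t = 2 * y - 1 := by rw [hy]; ring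
    rw [this]; field_simp; ring
  have h1 := klGen_exp_lower (t - log y)
  have h2 := klGen_exp_lower (-log y)
  have h3 : min 1 (t ^ 2) / 4 ≤ min 1 ((t - log y) ^ 2) + min 1 ((-log y) ^ 2) := by
    have ha : 0 ≤ min 1 ((t - log y) ^ 2) := le_min zero_le_one (sq_nonneg _)
    have hb : 0 ≤ min 1 ((-log y) ^ 2) := le_min zero_le_one (sq_nonneg _)
    have hm1 := min_le_left 1 (t ^ 2)
    have hm2 := min_le_right 1 (t ^ 2)
    rcases le_total 1 ((t - log y) ^ 2) with h | h
    · rw [min_eq_left h]; linarith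
    · rcases le_total 1 ((-log y) ^ 2) with h' | h'
      · rw [min_eq_left h']; linarith
      · rw [min_eq_right h, min_eq_right h']
        nlinarith [sq_nonneg (t - 2 * log y)]
  have h4 : 0 ≤ min 1 (t ^ 2) := le_min zero_le_one (sq_nonneg _)
  rw [e]
  nlinarith

lemma log_one_add_exp_mono {s t : ℝ} (h : s ≤ t) :
    log (1 + exp s) ≤ log (1 + exp t) ∧ log (1 + exp t) ≤ log (1 + exp s) + (t - s) := by
  have hs := exp_pos s
  refine ⟨log_le_log (by linarith) (by linarith [exp_le_exp.2 h]), ?_⟩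
  rw [← log_exp (t - s), ← log_mul (by positivity) (exp_pos _).ne']
  apply log_le_log (by positivity)
  have h1 : exp s * exp (t - s) = exp t := by rw [← exp_add]; congr 1; ring
  have h2 := one_le_exp (sub_nonneg.2 h)
  linarith [add_mul 1 (exp s) (exp (t - s))]

lemma isLogGenerator_klGen : IsLogGenerator klGen (fun t => t) (fun _ => 0) 2 where
  one_le := by norm_num
  le_eight := by norm_num
  decomp := ⟨-1, fun t => by rw [klGen_exp]; ring⟩
  a_zero := rfl
  c_zero := rfl
  a_lip s t := le_rfl
  c_lip s t := by simp
  cubic t ht := by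
    have := klGen_exp_cubic ht
    have h5 : 0 ≤ |t| ^ 3 := by positivity
    push_cast; linarith
  lower t := by
    have h4 : 0 ≤ min 1 (t ^ 2) := le_min zero_le_one (sq_nonneg _)
    linarith [klGen_exp_lower t]

lemma isLogGenerator_renyiGen : IsLogGenerator renyiGen (fun _ => 0) (fun t => 0 - t) 2 where
  one_le := by norm_num
  le_eight := by norm_num
  decomp := ⟨1, fun t => by rw [renyiGen_exp]; ring⟩
  a_zero := rfl
  c_zero := by simp
  a_lip s t := by simp
  c_lip s t := by rw [show 0 - s - (0 - t) = -(s - t) by ring, abs_neg]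
  cubic t ht := by
    have := renyiGen_exp_cubic ht
    have h5 : 0 ≤ |t| ^ 3 := by positivity
    push_cast; linarith
  lower t := by
    have h4 : 0 ≤ min 1 (t ^ 2) := le_min zero_le_one (sq_nonneg _)
    linarith [renyiGen_exp_lower t]

lemma isLogGenerator_jsGen : IsLogGenerator jsGen
    (fun t => (t + (log 2 - log (1 + exp t))) / 2) (fun t => (log 2 - log (1 + exp t)) / 2) 8 where
  one_le := by norm_num
  le_eight := by norm_num
  decomp := ⟨0, fun t => by
    rw [jsGen, log_exp, log_div (by positivity) (by norm_num), add_comm (exp t) 1]; ring⟩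
  a_zero := by norm_num
  c_zero := by norm_num
  a_lip s t := by
    rw [abs_le]
    rcases le_total s t with h | h <;> have h1 := log_one_add_exp_mono h
    · rw [abs_of_nonpos (by linarith)]; constructor <;> linarith [h1.1, h1.2]
    · rw [abs_of_nonneg (by linarith)]; constructor <;> linarith [h1.1, h1.2]
  c_lip s t := by
    rw [abs_le]
    rcases le_total s t with h | h <;> have h1 := log_one_add_exp_mono h
    · rw [abs_of_nonpos (by linarith)]; constructor <;> linarith [h1.1, h1.2]
    · rw [abs_of_nonneg (by linarith)]; constructor <;> linarith [h1.1, h1.2]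
  cubic t ht := by exact_mod_cast jsGen_exp_cubic ht
  lower := jsGen_exp_lower

end IsingDiv

/-! ### Single-spin flips and anti-concentration of the energy -/

namespace IsingDiv

open Real

set_option linter.unusedSectionVars false

lemma spin_sq {V : Type} (σ : Config V) (v : V) : spin σ v ^ 2 = 1 := by
  rcases Int.units_eq_one_or (σ v) with h | h <;> simp [spin, h]

lemma abs_spin {V : Type} (σ : Config V) (v : V) : |spin σ v| = 1 := by
  rcases Int.units_eq_one_or (σ v) with h | h <;> simp [spin, h]

/-- The configuration with the spin at `v` reversed. -/
def flip {V : Type} [DecidableEq V] (v : V) (σ : Config V) : Config V :=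
  Function.update σ v (-σ v)

section Flip

variable {V : Type} [DecidableEq V]

lemma flip_flip (v : V) (σ : Config V) : flip v (flip v σ) = σ := by
  simp [flip]

lemma flip_ne (v : V) (σ : Config V) : flip v σ ≠ σ := by
  intro h
  have h1 : -σ v = σ v := by simpa [flip] using congrFun h v
  rcases Int.units_eq_one_or (σ v) with h2 | h2 <;> rw [h2] at h1 <;> exact absurd h1 (by decide)

lemma spin_flip (v : V) (σ : Config V) :
    spin (flip v σ) = spin σ - Pi.single v (2 * spin σ v) := by
  ext u
  by_cases h : u = v
  · subst h; simp [spin, flip]; ring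
  · simp [spin, flip, h]

end Flip

lemma min_one_sq_half_sub_le (x y : ℝ) :
    min 1 (((x - y) / 2) ^ 2) ≤ min 1 (x ^ 2) + min 1 (y ^ 2) := by
  have hx : 0 ≤ min 1 (x ^ 2) := le_min zero_le_one (sq_nonneg x)
  have hy : 0 ≤ min 1 (y ^ 2) := le_min zero_le_one (sq_nonneg y)
  have h1 := min_le_left 1 (((x - y) / 2) ^ 2)
  have h2 := min_le_right 1 (((x - y) / 2) ^ 2)
  rcases le_total 1 (x ^ 2) with h | h
  · rw [min_eq_left h]; linarith
  · rcases le_total 1 (y ^ 2) with h' | h'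
    · rw [min_eq_left h']; linarith
    · rw [min_eq_right h, min_eq_right h']
      nlinarith [sq_nonneg (x + y)]

namespace IsingModel

variable {V : Type} [Fintype V] [DecidableEq V] {G : SimpleGraph V}

/-- The exponent of the weight. -/
noncomputable def energy (I : IsingModel G) (σ : Config V) : ℝ :=
  1 / 2 * (spin σ ⬝ᵥ (I.J *ᵥ spin σ)) + I.h ⬝ᵥ spin σ

/-- The field felt by the spin at `v`. -/
noncomputable def localField (I : IsingModel G) (v : V) (σ : Config V) : ℝ :=
  ∑ u, I.J v u * spin σ u + I.h v

/-- The sum of the squares of all parameters. -/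
noncomputable def normSq (I : IsingModel G) : ℝ := ∑ u, ∑ v, I.J u v ^ 2 + ∑ v, I.h v ^ 2

/-- The Gibbs expectation. -/
noncomputable def mean (I : IsingModel G) (g : Config V → ℝ) : ℝ := ∑ σ, I.gibbs σ * g σ

/-- The model whose parameters are the differences of the parameters of `ν` and `μ`. -/
noncomputable def diff (ν μ : IsingModel G) : IsingModel G where
  J := ν.J - μ.J
  h := ν.h - μ.h
  symm := ν.symm.sub μ.symm
  supp u v huv := by
    by_cases h : ν.J u v = 0
    · exact μ.supp u v (fun h' => huv (by simp [h, h']))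
    · exact ν.supp u v h

lemma weight_eq (I : IsingModel G) (σ : Config V) : I.weight σ = exp (I.energy σ) := rfl

lemma weight_pos (I : IsingModel G) (σ : Config V) : 0 < I.weight σ := exp_pos _

lemma Z_pos (I : IsingModel G) : 0 < I.Z :=
  Finset.sum_pos (fun σ _ => I.weight_pos σ) Finset.univ_nonempty

lemma gibbs_pos (I : IsingModel G) (σ : Config V) : 0 < I.gibbs σ :=
  div_pos (I.weight_pos σ) I.Z_pos

lemma sum_gibbs (I : IsingModel G) : ∑ σ, I.gibbs σ = 1 := by
  simp only [gibbs, ← Finset.sum_div]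
  exact div_self I.Z_pos.ne'

lemma J_self (I : IsingModel G) (v : V) : I.J v v = 0 := by
  by_contra h
  exact G.loopless.irrefl v (I.supp v v h)

lemma energy_diff (ν μ : IsingModel G) (σ : Config V) :
    (diff ν μ).energy σ = ν.energy σ - μ.energy σ := by
  simp only [energy, diff, Matrix.sub_mulVec, dotProduct_sub, sub_dotProduct]
  ring

lemma localField_diff (ν μ : IsingModel G) (v : V) (σ : Config V) :
    (diff ν μ).localField v σ = ν.localField v σ - μ.localField v σ := by
  simp only [localField, diff, Matrix.sub_apply, Pi.sub_apply, sub_mul, Finset.sum_sub_distrib]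
  ring

lemma energy_flip (I : IsingModel G) (v : V) (σ : Config V) :
    I.energy σ - I.energy (flip v σ) = 2 * (spin σ v * I.localField v σ) := by
  have hv : (I.J *ᵥ spin σ) v = ∑ u, I.J v u * spin σ u := rfl
  have hs : spin σ ⬝ᵥ (I.J *ᵥ Pi.single v (2 * spin σ v))
      = Pi.single v (2 * spin σ v) ⬝ᵥ (I.J *ᵥ spin σ) := by
    rw [Matrix.dotProduct_mulVec, ← Matrix.mulVec_transpose, I.symm.eq, dotProduct_comm]
  have hd : Pi.single v (2 * spin σ v) ⬝ᵥ (I.J *ᵥ Pi.single v (2 * spin σ v)) = 0 := by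
    rw [single_dotProduct]
    simp [Matrix.mulVec_single, I.J_self]
  simp only [energy, spin_flip, Matrix.mulVec_sub, dotProduct_sub, sub_dotProduct, hs, hd,
    single_dotProduct, dotProduct_single, hv, localField]
  ring

lemma localField_flip (I : IsingModel G) (u v : V) (σ : Config V) :
    I.localField v σ - I.localField v (flip u σ) = 2 * (I.J v u * spin σ u) := by
  simp only [localField, spin_flip, Pi.sub_apply, mul_sub, Finset.sum_sub_distrib]
  simp [Pi.single_apply]
  ring

section Mean

variable (I : IsingModel G)

lemma mean_const (c : ℝ) : I.mean (fun _ => c) = c := by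
  simp [mean, ← Finset.sum_mul, I.sum_gibbs]

lemma mean_mono {g g' : Config V → ℝ} (h : ∀ σ, g σ ≤ g' σ) : I.mean g ≤ I.mean g' :=
  Finset.sum_le_sum fun σ _ => mul_le_mul_of_nonneg_left (h σ) (I.gibbs_pos σ).le

lemma mean_add (g g' : Config V → ℝ) :
    I.mean (fun σ => g σ + g' σ) = I.mean g + I.mean g' := by
  simp [mean, mul_add, Finset.sum_add_distrib]

lemma mean_sub (g g' : Config V → ℝ) :
    I.mean (fun σ => g σ - g' σ) = I.mean g - I.mean g' := by
  simp [mean, mul_sub, Finset.sum_sub_distrib]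

lemma mean_const_mul (c : ℝ) (g : Config V → ℝ) :
    I.mean (fun σ => c * g σ) = c * I.mean g := by
  simp [mean, Finset.mul_sum, mul_left_comm]

lemma abs_mean_sub_le {g g' r : Config V → ℝ} (h : ∀ σ, |g σ - g' σ| ≤ r σ) :
    |I.mean g - I.mean g'| ≤ I.mean r := by
  rw [← mean_sub]
  refine (Finset.abs_sum_le_sum_abs _ _).trans (Finset.sum_le_sum fun σ _ => ?_)
  rw [abs_mul, abs_of_pos (I.gibbs_pos σ)]
  exact mul_le_mul_of_nonneg_left (h σ) (I.gibbs_pos σ).le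

lemma abs_mean_le {g : Config V → ℝ} {B : ℝ} (h : ∀ σ, |g σ| ≤ B) : |I.mean g| ≤ B := by
  have := I.abs_mean_sub_le (g := g) (g' := fun _ => 0) (r := fun _ => B) (by simpa using h)
  simpa [mean_const] using this

end Mean

/-- A marginally bounded model gives comparable weight to configurations that differ in one spin.
This is the only consequence of marginal boundedness that the argument uses. -/
def FlipBounded (I : IsingModel G) (b : ℝ) : Prop :=
  ∀ σ v, b * (I.gibbs σ + I.gibbs (flip v σ)) ≤ I.gibbs σ

lemma MarginallyBounded.flipBounded {I : IsingModel G} {b : ℝ} (h : I.MarginallyBounded b) :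
    I.FlipBounded b := by
  classical
  intro σ v
  have h1 := h (Finset.univ.erase v) σ v (σ v) (by simp)
  have e1 : I.prob (fun σ' => σ' v = σ v ∧ ∀ u ∈ Finset.univ.erase v, σ' u = σ u)
      = I.gibbs σ := by
    have : ∀ σ' : Config V, (σ' v = σ v ∧ ∀ u ∈ Finset.univ.erase v, σ' u = σ u) ↔ σ' = σ := by
      intro σ'
      refine ⟨fun hh => funext fun u => ?_, fun hh => by subst hh; simp⟩
      by_cases huv : u = v
      · rw [huv]; exact hh.1
      · exact hh.2 u (by simp [huv])
    simp only [prob, this]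
    rw [Finset.sum_ite_eq' Finset.univ σ]
    simp
  have e2 : I.prob (fun σ' => ∀ u ∈ Finset.univ.erase v, σ' u = σ u)
      = I.gibbs σ + I.gibbs (flip v σ) := by
    have : ∀ σ' : Config V, (∀ u ∈ Finset.univ.erase v, σ' u = σ u) ↔
        σ' ∈ ({σ, flip v σ} : Finset (Config V)) := by
      intro σ'
      rw [Finset.mem_insert, Finset.mem_singleton]
      constructor
      · intro hh
        by_cases hv : σ' v = σ v
        · left; funext u
          by_cases huv : u = v
          · rw [huv]; exact hv
          · exact hh u (by simp [huv])
        · right; funext u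
          by_cases huv : u = v
          · subst huv
            simp only [flip, Function.update_self]
            exact Int.units_ne_iff_eq_neg.1 hv
          · simp [flip, huv, hh u (by simp [huv])]
      · rintro (rfl | rfl) u hu
        · rfl
        · simp [flip, (Finset.mem_erase.1 hu).1]
    simp only [prob, this]
    rw [Finset.sum_ite_mem, Finset.univ_inter, Finset.sum_pair (flip_ne v σ).symm]
  rw [e1, e2, le_div_iff₀ (add_pos (I.gibbs_pos _) (I.gibbs_pos _))] at h1
  exact h1

section FlipBounded

variable {I : IsingModel G} {b : ℝ}

lemma FlipBounded.le_one (h : I.FlipBounded b) (v : V) : b ≤ 1 := by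
  have h1 := h (fun _ => 1) v
  by_contra! hb
  nlinarith [I.gibbs_pos (fun _ => 1), I.gibbs_pos (flip v (fun _ => 1))]

lemma FlipBounded.flip_le (h : I.FlipBounded b) (hb : 0 < b) (v : V) (σ : Config V) :
    b * I.gibbs (flip v σ) ≤ I.gibbs σ := by
  nlinarith [h σ v, I.gibbs_pos σ]

lemma FlipBounded.two_mul_localField_le (h : I.FlipBounded b) (hb : 0 < b) (v : V)
    (σ : Config V) : |2 * I.localField v σ| ≤ log (1 / b) := by
  have key : ∀ τ : Config V, I.energy (flip v τ) - I.energy τ ≤ log (1 / b) := by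
    intro τ
    have h1 := h.flip_le hb v τ
    rw [gibbs, gibbs, ← mul_div_assoc, div_le_div_iff_of_pos_right I.Z_pos, weight_eq, weight_eq]
      at h1
    rw [le_log_iff_exp_le (by positivity), exp_sub, div_le_div_iff₀ (exp_pos _) hb]
    linarith
  have h1 := key σ
  have h2 := key (flip v σ)
  rw [flip_flip] at h2
  have h3 := I.energy_flip v σ
  have h4 : |2 * I.localField v σ| = |2 * (spin σ v * I.localField v σ)| := by
    rw [abs_mul, abs_mul, abs_mul, abs_spin, one_mul]
  rw [h4, ← h3, abs_le]
  constructor <;> linarith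

/-- Pairing each configuration with its flip bounds a mean from below. -/
lemma FlipBounded.mean_ge (h : I.FlipBounded b) (hb : 0 < b) (v : V) {ψ F : Config V → ℝ}
    (h0 : ∀ σ, 0 ≤ ψ σ) (hF : ∀ σ, F σ ≤ ψ σ + ψ (flip v σ)) :
    b / 2 * I.mean F ≤ I.mean ψ := by
  have hb1 := h.le_one v
  have e : I.mean ψ = ∑ σ, I.gibbs (flip v σ) * ψ (flip v σ) :=
    (Equiv.sum_comp (show Function.Involutive (flip v) from flip_flip v).toPerm
      (fun σ => I.gibbs σ * ψ σ)).symm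
  have h1 : b * I.mean F ≤ I.mean ψ + I.mean ψ := by
    nth_rw 2 [e]
    rw [mean, mean, ← Finset.sum_add_distrib, Finset.mul_sum]
    refine Finset.sum_le_sum fun σ _ => ?_
    have g1 := h.flip_le hb v (flip v σ)
    rw [flip_flip] at g1
    have g0 := I.gibbs_pos σ
    have g2 : b * I.gibbs σ ≤ I.gibbs σ := by nlinarith
    calc b * (I.gibbs σ * F σ) ≤ b * I.gibbs σ * (ψ σ + ψ (flip v σ)) := by
          rw [← mul_assoc]; exact mul_le_mul_of_nonneg_left (hF σ) (by positivity)
      _ ≤ _ := by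
          rw [mul_add]
          exact add_le_add (mul_le_mul_of_nonneg_right g2 (h0 _))
            (mul_le_mul_of_nonneg_right g1 (h0 _))
  linarith

/-- The energy of any model `D` fluctuates under a flip-bounded measure `I` at least as much as
the local fields of `D`. -/
lemma FlipBounded.mean_energy_ge_localField (h : I.FlipBounded b) (hb : 0 < b)
    (D : IsingModel G) (m : ℝ) (v : V) :
    b / 2 * I.mean (fun σ => min 1 (D.localField v σ ^ 2))
      ≤ I.mean (fun σ => min 1 ((D.energy σ - m) ^ 2)) := by
  refine h.mean_ge hb v (fun σ => le_min zero_le_one (sq_nonneg _)) fun σ => ?_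
  have h1 := min_one_sq_half_sub_le (D.energy σ - m) (D.energy (flip v σ) - m)
  have h2 : ((D.energy σ - m - (D.energy (flip v σ) - m)) / 2) ^ 2 = D.localField v σ ^ 2 := by
    rw [sub_sub_sub_cancel_right, D.energy_flip, mul_div_cancel_left₀ _ two_ne_zero, mul_pow,
      spin_sq, one_mul]
  rwa [h2] at h1

lemma FlipBounded.mean_localField_ge (h : I.FlipBounded b) (hb : 0 < b)
    (D : IsingModel G) (u v : V) :
    b / 2 * min 1 (D.J v u ^ 2) ≤ I.mean (fun σ => min 1 (D.localField v σ ^ 2)) := by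
  nth_rw 1 [← I.mean_const (min 1 (D.J v u ^ 2))]
  refine h.mean_ge hb u (fun σ => le_min zero_le_one (sq_nonneg _)) fun σ => ?_
  have h1 := min_one_sq_half_sub_le (D.localField v σ) (D.localField v (flip u σ))
  rwa [D.localField_flip, mul_div_cancel_left₀ _ two_ne_zero, mul_pow, spin_sq, mul_one] at h1

/-- A nonzero external field either dominates the local field, or is dominated by some
interaction. -/
lemma FlipBounded.mean_localField_ge_field (h : I.FlipBounded b) (hb : 0 < b)
    (D : IsingModel G) (v : V) :
    b / 2 * min 1 ((D.h v / (2 * Fintype.card V)) ^ 2)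
      ≤ I.mean (fun σ => min 1 (D.localField v σ ^ 2)) := by
  have hn : (1 : ℝ) ≤ Fintype.card V := by exact_mod_cast Fintype.card_pos_iff.2 ⟨v⟩
  have hn0 : (0 : ℝ) < 2 * Fintype.card V := by linarith
  by_cases hu : ∃ u, |D.h v / (2 * Fintype.card V)| ≤ |D.J v u|
  · obtain ⟨u, hu⟩ := hu
    refine le_trans ?_ (h.mean_localField_ge hb D u v)
    exact mul_le_mul_of_nonneg_left (min_le_min_left 1 (sq_le_sq.2 hu)) (by positivity)
  · -- the interactions at `v` add up to at most half of the external field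
    push Not at hu
    have hb1 := h.le_one v
    have h0 : 0 ≤ min 1 ((D.h v / (2 * Fintype.card V)) ^ 2) := le_min zero_le_one (sq_nonneg _)
    have h1 : min 1 ((D.h v / (2 * Fintype.card V)) ^ 2)
        ≤ I.mean (fun σ => min 1 (D.localField v σ ^ 2)) := by
      nth_rw 1 [← I.mean_const (min 1 ((D.h v / (2 * Fintype.card V)) ^ 2))]
      refine I.mean_mono fun σ => ?_
      gcongr min 1 ?_
      apply sq_le_sq.2
      have h2 : |∑ u, D.J v u * spin σ u| ≤ |D.h v| / 2 := by
        refine (Finset.abs_sum_le_sum_abs _ _).trans ?_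
        have : ∀ u ∈ Finset.univ, |D.J v u * spin σ u| ≤ |D.h v / (2 * Fintype.card V)| := by
          intro u _
          rw [abs_mul, abs_spin, mul_one]; exact (hu u).le
        refine (Finset.sum_le_card_nsmul _ _ _ this).trans (le_of_eq ?_)
        rw [abs_div, abs_of_pos hn0, nsmul_eq_mul, Finset.card_univ]
        field_simp
      have h3 : |D.h v / (2 * Fintype.card V)| ≤ |D.h v| / 2 := by
        rw [abs_div, abs_of_pos hn0]
        gcongr; linarith
      have h4 : |D.h v| ≤ |D.localField v σ| + |∑ u, D.J v u * spin σ u| := by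
        have : D.h v = D.localField v σ - ∑ u, D.J v u * spin σ u := by simp [localField]
        nth_rw 1 [this]; exact abs_sub _ _
      linarith
    nlinarith

lemma exists_large_parameter [Nonempty V] (D : IsingModel G) :
    (∃ u v, D.normSq / (2 * (Fintype.card V : ℝ) ^ 2) ≤ D.J v u ^ 2) ∨
    (∃ v, D.normSq / (2 * (Fintype.card V : ℝ) ^ 2) ≤ D.h v ^ 2) := by
  by_contra! hc
  obtain ⟨h1, h2⟩ := hc
  have hn : (1 : ℝ) ≤ Fintype.card V := by exact_mod_cast Fintype.card_pos
  set n := (Fintype.card V : ℝ) with hndef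
  set q := D.normSq / (2 * n ^ 2) with hq
  have e1 : ∑ u, ∑ v, D.J u v ^ 2 < n * (n * q) := by
    have : ∀ u ∈ Finset.univ, ∑ v, D.J u v ^ 2 < n * q := by
      intro u _
      have := Finset.sum_lt_sum_of_nonempty Finset.univ_nonempty (fun v _ => h1 v u)
      simpa [hndef] using this
    have := Finset.sum_lt_sum_of_nonempty Finset.univ_nonempty this
    simpa [hndef] using this
  have e2 : ∑ v, D.h v ^ 2 < n * q := by
    have := Finset.sum_lt_sum_of_nonempty Finset.univ_nonempty (fun v _ => h2 v)
    simpa [hndef] using this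
  have hq0 : 0 ≤ q := by
    have : 0 ≤ D.normSq := by unfold normSq; positivity
    positivity
  have e3 : D.normSq = 2 * (n * (n * q)) := by rw [hq]; field_simp
  have e4 : D.normSq < n * (n * q) + n * q := add_lt_add e1 e2
  nlinarith [mul_nonneg (sub_nonneg.2 hn) (mul_nonneg (zero_le_one.trans hn) hq0)]

/-- Anti-concentration: under a flip-bounded measure, the energy of a model `D` deviates from every
constant by an amount governed by the size of the parameters of `D`. -/
lemma FlipBounded.mean_energy_ge [Nonempty V] (h : I.FlipBounded b) (hb : 0 < b)
    (D : IsingModel G) (m : ℝ) :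
    b ^ 2 / 4 * min 1 (D.normSq / (8 * (Fintype.card V : ℝ) ^ 4))
      ≤ I.mean (fun σ => min 1 ((D.energy σ - m) ^ 2)) := by
  have hn : (1 : ℝ) ≤ Fintype.card V := by exact_mod_cast Fintype.card_pos
  set n := (Fintype.card V : ℝ) with hndef
  have hq0 : 0 ≤ D.normSq := by unfold normSq; positivity
  have step : ∀ v, b / 2 * min 1 (D.normSq / (8 * n ^ 4))
      ≤ I.mean (fun σ => min 1 (D.localField v σ ^ 2)) →
      b ^ 2 / 4 * min 1 (D.normSq / (8 * n ^ 4))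
      ≤ I.mean (fun σ => min 1 ((D.energy σ - m) ^ 2)) := by
    intro v hv
    refine le_trans ?_ (h.mean_energy_ge_localField hb D m v)
    calc _ = b / 2 * (b / 2 * min 1 (D.normSq / (8 * n ^ 4))) := by ring
      _ ≤ _ := by gcongr
  have e : D.normSq / (8 * n ^ 4) = D.normSq / (2 * n ^ 2) * (1 / (2 * n)) ^ 2 := by
    field_simp; norm_num
  rcases D.exists_large_parameter with ⟨u, v, huv⟩ | ⟨v, hv⟩
  · refine step v (le_trans ?_ (h.mean_localField_ge hb D u v))
    gcongr
    refine le_trans ?_ huv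
    rw [e]
    apply mul_le_of_le_one_right (by positivity)
    apply pow_le_one₀ (by positivity)
    rw [div_le_one (by positivity)]; linarith
  · refine step v (le_trans ?_ (h.mean_localField_ge_field hb D v))
    gcongr
    rw [e, div_eq_mul_one_div (D.h v), mul_pow]
    gcongr

end FlipBounded

/-! ### Upper bounds on the energy -/

lemma abs_energy_le_sum (D : IsingModel G) (σ : Config V) :
    |D.energy σ| ≤ 1 / 2 * ∑ u, ∑ v, |D.J u v| + ∑ v, |D.h v| := by
  have h1 : |spin σ ⬝ᵥ (D.J *ᵥ spin σ)| ≤ ∑ u, ∑ v, |D.J u v| := by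
    refine (Finset.abs_sum_le_sum_abs _ _).trans (Finset.sum_le_sum fun u _ => ?_)
    rw [abs_mul, abs_spin, one_mul]
    refine (Finset.abs_sum_le_sum_abs _ _).trans (Finset.sum_le_sum fun v _ => ?_)
    rw [abs_mul, abs_spin, mul_one]
  have h2 : |D.h ⬝ᵥ spin σ| ≤ ∑ v, |D.h v| := by
    refine (Finset.abs_sum_le_sum_abs _ _).trans (Finset.sum_le_sum fun v _ => ?_)
    rw [abs_mul, abs_spin, mul_one]
  refine (abs_add_le _ _).trans ?_
  rw [abs_mul, abs_of_pos (show (0 : ℝ) < 1 / 2 by norm_num)]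
  linarith

lemma energy_sq_le (D : IsingModel G) (σ : Config V) :
    D.energy σ ^ 2 ≤ 2 * (Fintype.card V : ℝ) ^ 2 * D.normSq := by
  rcases isEmpty_or_nonempty V with hV | hV
  · simp [energy, dotProduct]
  have hn : (1 : ℝ) ≤ Fintype.card V := by exact_mod_cast Fintype.card_pos
  set n := (Fintype.card V : ℝ) with hndef
  set x := ∑ u, ∑ v, |D.J u v| with hx
  set y := ∑ v, |D.h v| with hy
  have h1 : x ^ 2 ≤ n ^ 2 * ∑ u, ∑ v, D.J u v ^ 2 := by
    have := sq_sum_le_card_mul_sum_sq (s := Finset.univ) (f := fun p : V × V => |D.J p.1 p.2|)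
    simpa [Fintype.sum_prod_type, sq_abs, hndef, hx, sq] using this
  have h2 : y ^ 2 ≤ n * ∑ v, D.h v ^ 2 := by
    have := sq_sum_le_card_mul_sum_sq (s := Finset.univ) (f := fun p : V => |D.h p|)
    simpa [sq_abs] using this
  have h3 : D.energy σ ^ 2 ≤ (1 / 2 * x + y) ^ 2 := by
    rw [sq_le_sq]
    exact (D.abs_energy_le_sum σ).trans (le_abs_self _)
  have hJ : 0 ≤ ∑ u, ∑ v, D.J u v ^ 2 := by positivity
  have hh : 0 ≤ ∑ v, D.h v ^ 2 := by positivity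
  have h4 : n * ∑ v, D.h v ^ 2 ≤ n ^ 2 * ∑ v, D.h v ^ 2 := by
    gcongr; nlinarith
  have h5 : 0 ≤ n ^ 2 * ∑ u, ∑ v, D.J u v ^ 2 := by positivity
  rw [normSq]
  nlinarith [sq_nonneg (1 / 2 * x - y)]

lemma abs_energy_le_of_localField (D : IsingModel G) {L : ℝ}
    (h : ∀ v σ, |D.localField v σ| ≤ L) (σ : Config V) :
    |D.energy σ| ≤ ((Fintype.card V : ℝ) ^ 2 / 2 + Fintype.card V) * L := by
  have hJ : ∀ u v, |D.J v u| ≤ L := by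
    intro u v
    have h1 := D.localField_flip u v σ
    have h2 := abs_sub (D.localField v σ) (D.localField v (flip u σ))
    rw [h1, abs_mul, abs_mul, abs_spin, abs_two] at h2
    linarith [h v σ, h v (flip u σ)]
  have hh : ∀ v, |D.h v| ≤ L := by
    intro v
    have e : D.localField v (fun _ => 1) + D.localField v (fun _ => -1) = 2 * D.h v := by
      simp [localField, spin]; ring
    have h2 := abs_add_le (D.localField v (fun _ => 1)) (D.localField v (fun _ => -1))
    rw [e, abs_mul, abs_two] at h2
    linarith [h v (fun _ => 1), h v (fun _ => -1)]
  have s1 : ∑ u, ∑ v, |D.J u v| ≤ (Fintype.card V : ℝ) * (Fintype.card V * L) := by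
    have : ∀ u ∈ Finset.univ, ∑ v, |D.J u v| ≤ Fintype.card V * L := by
      intro u _
      have := Finset.sum_le_card_nsmul Finset.univ (fun v => |D.J u v|) L (fun v _ => hJ v u)
      simpa using this
    have := Finset.sum_le_card_nsmul Finset.univ _ _ this
    simpa using this
  have s2 : ∑ v, |D.h v| ≤ Fintype.card V * L := by
    have := Finset.sum_le_card_nsmul Finset.univ (fun v => |D.h v|) L (fun v _ => hh v)
    simpa using this
  have := D.abs_energy_le_sum σ
  linarith

/-! ### The log-likelihood ratio -/

/-- The logarithm of the likelihood ratio `ν σ / μ σ`. -/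
noncomputable def logRatio (ν μ : IsingModel G) (σ : Config V) : ℝ :=
  (diff ν μ).energy σ - log ν.Z + log μ.Z

lemma exp_logRatio (ν μ : IsingModel G) (σ : Config V) :
    exp (logRatio ν μ σ) = ν.gibbs σ / μ.gibbs σ := by
  rw [logRatio, energy_diff, exp_add, exp_sub, exp_sub, exp_log ν.Z_pos, exp_log μ.Z_pos,
    gibbs, gibbs, weight_eq, weight_eq]
  have := ν.Z_pos.ne'
  have := μ.Z_pos.ne'
  field_simp

lemma Z_eq_mean (ν μ : IsingModel G) :
    ν.Z / μ.Z = μ.mean (fun σ => exp ((diff ν μ).energy σ)) := by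
  simp only [mean, gibbs, Z, weight_eq, energy_diff, exp_sub]
  rw [Finset.sum_div]
  refine Finset.sum_congr rfl fun σ _ => ?_
  have := (exp_pos (μ.energy σ)).ne'
  field_simp

lemma abs_logRatio_le {ν μ : IsingModel G} {M : ℝ} (h : ∀ σ, |(diff ν μ).energy σ| ≤ M)
    (σ : Config V) : |logRatio ν μ σ| ≤ 2 * M := by
  have hz : 0 < ν.Z / μ.Z := div_pos ν.Z_pos μ.Z_pos
  have h1 : exp (-M) ≤ ν.Z / μ.Z := by
    rw [Z_eq_mean, ← μ.mean_const (exp (-M))]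
    exact μ.mean_mono fun σ => exp_le_exp.2 (abs_le.1 (h σ)).1
  have h2 : ν.Z / μ.Z ≤ exp M := by
    rw [Z_eq_mean, ← μ.mean_const (exp M)]
    exact μ.mean_mono fun σ => exp_le_exp.2 (abs_le.1 (h σ)).2
  rw [← le_log_iff_exp_le hz, log_div ν.Z_pos.ne' μ.Z_pos.ne'] at h1
  rw [← log_le_iff_le_exp hz, log_div ν.Z_pos.ne' μ.Z_pos.ne'] at h2
  have h3 := abs_le.1 (h σ)
  rw [logRatio, abs_le]
  constructor <;> linarith [h3.1, h3.2]

lemma fDiv_eq_mean (ν μ : IsingModel G) (f : ℝ → ℝ) :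
    ν.fDiv μ f = μ.mean (fun σ => f (exp (logRatio ν μ σ))) := by
  simp only [fDiv, mean, exp_logRatio]

lemma fDiv_eq_mean_add_mean (ν μ : IsingModel G) {f a c : ℝ → ℝ} {k : ℕ}
    (hf : IsLogGenerator f a c k) :
    ν.fDiv μ f = ν.mean (fun σ => a (logRatio ν μ σ)) + μ.mean (fun σ => c (logRatio ν μ σ)) := by
  obtain ⟨β, hβ⟩ := hf.decomp
  have e : ∀ σ, μ.gibbs σ * exp (logRatio ν μ σ) = ν.gibbs σ := fun σ => by
    rw [exp_logRatio, mul_div_cancel₀ _ (μ.gibbs_pos σ).ne']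
  rw [fDiv_eq_mean]
  simp only [mean, hβ]
  have : ∀ σ, μ.gibbs σ * (exp (logRatio ν μ σ) * a (logRatio ν μ σ) + c (logRatio ν μ σ)
      + β * (exp (logRatio ν μ σ) - 1))
      = ν.gibbs σ * a (logRatio ν μ σ) + μ.gibbs σ * c (logRatio ν μ σ)
        + β * (ν.gibbs σ - μ.gibbs σ) := fun σ => by
    linear_combination (a (logRatio ν μ σ) + β) * e σ
  simp only [this, Finset.sum_add_distrib, ← Finset.mul_sum, Finset.sum_sub_distrib, sum_gibbs]
  ring

end IsingModel

end IsingDiv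

/-! ### Accuracy of the two estimates -/

namespace IsingDiv

open Real

set_option linter.unusedSectionVars false

/-- The inverse `1 / θ` of the relative accuracy `θ` to which empirical means are computed, for
models with `n` vertices and marginal bound `1 / K`, when the final relative error is `1 / E`.
The constant is the one that the direct estimate needs: `1382400000 = 3 * 460800000`, where
`1 / (460800000 * K ^ 2 * (n + 1) ^ 6 * E ^ 2)` is the lower bound on the divergence, and `3` counts
the two empirical means and the normalization. -/
noncomputable def invAccuracy (K n : ℕ) (E : ℝ) : ℝ :=
  1382400000 * (K : ℝ) ^ 3 * ((n : ℝ) + 1) ^ 8 * E ^ 3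

namespace IsingModel

variable {V : Type} [Fintype V] [DecidableEq V] {G : SimpleGraph V}

/-- The Gibbs variance of the energy difference of `ν` and `μ`. -/
noncomputable def energyVariance (ν μ : IsingModel G) : ℝ :=
  μ.mean (fun σ => ((diff ν μ).energy σ - μ.mean (diff ν μ).energy) ^ 2)

lemma energyVariance_eq (ν μ : IsingModel G) :
    energyVariance ν μ
      = μ.mean (fun σ => (diff ν μ).energy σ ^ 2) - μ.mean (diff ν μ).energy ^ 2 := by
  set m := μ.mean (diff ν μ).energy with hm
  have e : energyVariance ν μ
      = μ.mean (fun σ => ((diff ν μ).energy σ ^ 2 - 2 * m * (diff ν μ).energy σ) + m ^ 2) := by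
    unfold energyVariance
    congr 1; funext σ; ring
  rw [e, mean_add, mean_sub, mean_const, mean_const_mul, ← hm]
  ring

lemma normSq_nonneg (D : IsingModel G) : 0 ≤ D.normSq := by unfold normSq; positivity

/-- The normalization `log (ν.Z / μ.Z)` differs from the mean energy difference by at most the
variance, because `1 + y ≤ exp y ≤ 1 + y + y ^ 2` for `|y| ≤ 1`. -/
lemma log_Z_sub_mean_mem (ν μ : IsingModel G)
    (h : ∀ σ, |(diff ν μ).energy σ - μ.mean (diff ν μ).energy| ≤ 1) :
    0 ≤ log ν.Z - log μ.Z - μ.mean (diff ν μ).energy ∧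
      log ν.Z - log μ.Z - μ.mean (diff ν μ).energy ≤ energyVariance ν μ := by
  set m := μ.mean (diff ν μ).energy with hm
  have hz : 0 < ν.Z / μ.Z := div_pos ν.Z_pos μ.Z_pos
  have e : ν.Z / μ.Z * exp (-m) = μ.mean (fun σ => exp ((diff ν μ).energy σ - m)) := by
    rw [Z_eq_mean, mul_comm, ← mean_const_mul]
    congr 1; funext σ; rw [← exp_add]; congr 1; ring
  have h1 : 1 ≤ ν.Z / μ.Z * exp (-m) := by
    have : μ.mean (fun σ => 1 + ((diff ν μ).energy σ - m)) = 1 := by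
      rw [mean_add, mean_sub, mean_const, mean_const, ← hm]; ring
    rw [e, ← this]
    exact μ.mean_mono fun σ => by linarith [add_one_le_exp ((diff ν μ).energy σ - m)]
  have h2 : ν.Z / μ.Z * exp (-m) ≤ 1 + energyVariance ν μ := by
    have : μ.mean (fun σ => 1 + ((diff ν μ).energy σ - m) + ((diff ν μ).energy σ - m) ^ 2)
        = 1 + energyVariance ν μ := by
      rw [mean_add, mean_add, mean_sub, mean_const, mean_const, ← hm, energyVariance, ← hm]; ring
    rw [e, ← this]
    refine μ.mean_mono fun σ => ?_
    have := (abs_le.1 (abs_exp_sub_one_sub_id_le (h σ))).2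
    linarith
  have h3 : log ν.Z - log μ.Z - m = log (ν.Z / μ.Z * exp (-m)) := by
    rw [log_mul hz.ne' (exp_pos _).ne', log_exp, log_div ν.Z_pos.ne' μ.Z_pos.ne']; ring
  rw [h3]
  refine ⟨log_nonneg h1, ?_⟩
  have := log_le_sub_one_of_pos (show 0 < ν.Z / μ.Z * exp (-m) by linarith)
  linarith

/-- If all energy differences are at most `M`, which is small, then the divergence is the variance
of the energy difference up to the factor `k` and a relative error of order `M`. -/
lemma abs_fDiv_sub_energyVariance_le (ν μ : IsingModel G) {f a c : ℝ → ℝ} {k : ℕ}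
    (hf : IsLogGenerator f a c k) {M : ℝ} (hM : ∀ σ, |(diff ν μ).energy σ| ≤ M)
    (hM1 : M ≤ 1 / 8) :
    |ν.fDiv μ f - energyVariance ν μ / k| ≤ 75 * M * (energyVariance ν μ / k) := by
  have hM0 : 0 ≤ M := (abs_nonneg _).trans (hM (fun _ => 1))
  have hk1 : (1 : ℝ) ≤ k := by exact_mod_cast hf.one_le
  have hk8 : (k : ℝ) ≤ 8 := by exact_mod_cast hf.le_eight
  have hm : |μ.mean (diff ν μ).energy| ≤ M := μ.abs_mean_le hM
  set m := μ.mean (diff ν μ).energy with hmdef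
  set v := energyVariance ν μ with hv
  set z := log ν.Z - log μ.Z with hz
  have hdev : ∀ σ, |(diff ν μ).energy σ - m| ≤ 2 * M := fun σ =>
    (abs_sub _ _).trans (by linarith [hM σ])
  have hv0 : 0 ≤ v := by
    have := μ.mean_mono (g := fun _ => 0)
      (g' := fun σ => ((diff ν μ).energy σ - m) ^ 2) (fun σ => sq_nonneg _)
    rwa [mean_const] at this
  have hvM : v ≤ 4 * M ^ 2 := by
    rw [← μ.mean_const (4 * M ^ 2), hv, energyVariance]
    refine μ.mean_mono fun σ => ?_
    have := sq_le_sq' (by linarith [(abs_le.1 (hdev σ)).1]) (abs_le.1 (hdev σ)).2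
    linarith [this]
  obtain ⟨hz0, hz1⟩ := log_Z_sub_mean_mem ν μ (fun σ => (hdev σ).trans (by linarith))
  rw [← hmdef, ← hz] at hz0 hz1
  rw [← hv] at hz1
  have hl2 : μ.mean (fun σ => logRatio ν μ σ ^ 2) = v + (z - m) ^ 2 := by
    have e : ∀ σ, logRatio ν μ σ ^ 2 = ((diff ν μ).energy σ - m) ^ 2
        - 2 * (z - m) * ((diff ν μ).energy σ - m) + (z - m) ^ 2 := fun σ => by
      rw [logRatio, hz]; ring
    simp only [e]
    rw [mean_add, mean_sub, mean_const, mean_const_mul, mean_sub, mean_const, ← hmdef, hv,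
      energyVariance, ← hmdef]
    ring
  -- `0 ≤ z - m ≤ v ≤ 4 * M ^ 2`, so the offset of the mean of `l` is negligible
  have hz2 : (z - m) ^ 2 ≤ M * v := by nlinarith
  have hl := abs_logRatio_le hM
  have h1 : |ν.fDiv μ f - μ.mean (fun σ => logRatio ν μ σ ^ 2 / k)|
      ≤ μ.mean (fun σ => 4 * M * logRatio ν μ σ ^ 2) := by
    rw [fDiv_eq_mean]
    refine μ.abs_mean_sub_le fun σ => (hf.cubic _ ((hl σ).trans (by linarith))).trans ?_
    rw [pow_succ, sq_abs]
    nlinarith [mul_le_mul_of_nonneg_left (hl σ) (sq_nonneg (logRatio ν μ σ))]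
  have h2 : μ.mean (fun σ => logRatio ν μ σ ^ 2 / k) = (v + (z - m) ^ 2) / k := by
    simp only [div_eq_inv_mul]
    rw [mean_const_mul, hl2]
  rw [mean_const_mul, hl2, h2] at h1
  have h3 : v ≤ 8 * (v / k) := by
    rw [← mul_div_assoc, le_div_iff₀ (by linarith)]; nlinarith
  have h4 : (z - m) ^ 2 / k ≤ M * (v / k) := by
    rw [← mul_div_assoc]; gcongr
  have h5 : 0 ≤ (z - m) ^ 2 / k := by positivity
  have h6 : 4 * M * (v + (z - m) ^ 2) ≤ 5 * M * v := by
    nlinarith [mul_le_mul_of_nonneg_left hz2 hM0]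
  have h7 : 5 * M * v ≤ 5 * M * (8 * (v / k)) := by gcongr
  rw [add_div] at h1
  have h8 := abs_le.1 h1
  have h9 : 0 ≤ v / k := by positivity
  have h10 := mul_nonneg hM0 h9
  rw [abs_le]
  constructor <;> nlinarith

section Accuracy

variable {ν μ : IsingModel G} {f a c : ℝ → ℝ} {k : ℕ} {b E : ℝ} {K : ℕ}

lemma fDiv_ge (hf : IsLogGenerator f a c k) [Nonempty V] (hμ : μ.FlipBounded b) (hb : 0 < b) :
    b ^ 2 / 320 * min 1 ((diff ν μ).normSq / (8 * (Fintype.card V : ℝ) ^ 4)) ≤ ν.fDiv μ f := by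
  have h1 := hμ.mean_energy_ge hb (diff ν μ) (log ν.Z - log μ.Z)
  have h2 : 1 / 80 * μ.mean (fun σ => min 1 (((diff ν μ).energy σ - (log ν.Z - log μ.Z)) ^ 2))
      ≤ ν.fDiv μ f := by
    rw [← mean_const_mul, fDiv_eq_mean]
    refine μ.mean_mono fun σ => ?_
    have := hf.lower (logRatio ν μ σ)
    rw [show (diff ν μ).energy σ - (log ν.Z - log μ.Z) = logRatio ν μ σ by rw [logRatio]; ring]
    linarith
  linarith

lemma fDiv_nonneg (hf : IsLogGenerator f a c k) : 0 ≤ ν.fDiv μ f := by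
  rw [fDiv_eq_mean, ← μ.mean_const 0]
  refine μ.mean_mono fun σ => le_trans ?_ (hf.lower _)
  have : 0 ≤ min 1 (logRatio ν μ σ ^ 2) := le_min zero_le_one (sq_nonneg _)
  positivity

lemma fDiv_eq_zero_of_energy (hf : IsLogGenerator f a c k)
    (h : ∀ σ, (diff ν μ).energy σ = 0) : ν.fDiv μ f = 0 := by
  have h0 : ∀ σ, logRatio ν μ σ = 0 := fun σ => by
    have := abs_logRatio_le (M := 0) (fun τ => by rw [h τ, abs_zero]) σ
    simpa using this
  rw [fDiv_eq_mean_add_mean ν μ hf]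
  simp [h0, hf.a_zero, hf.c_zero, mean_const]

/-- Accuracy of the variance estimate, for models with close parameters. The energy difference is
at most `B`, and `x₁`, `x₂` are empirical first and second moments. -/
lemma abs_moment_estimate_sub_fDiv_le (hf : IsLogGenerator f a c k) [Nonempty V]
    (hμ : μ.FlipBounded b) (hb : 0 < b) (hK : 1 / b ≤ K) (hE : 1 ≤ E) {n : ℕ}
    (hn : Fintype.card V = n) {B : ℝ} (hB : 0 ≤ B)
    (hB2 : B ^ 2 = 2 * ((n : ℝ) + 1) ^ 2 * (diff ν μ).normSq)
    (hclose : B ^ 2 * (300 * E) ^ 2 < 1) {x₁ x₂ : ℝ}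
    (h₁ : |x₁ - μ.mean (diff ν μ).energy| ≤ B * (1 / invAccuracy K n E))
    (h₂ : |x₂ - μ.mean (fun σ => (diff ν μ).energy σ ^ 2)| ≤ B ^ 2 * (1 / invAccuracy K n E)) :
    |(x₂ - x₁ ^ 2) / k - ν.fDiv μ f| ≤ 1 / E * ν.fDiv μ f := by
  have hn1 : (1 : ℝ) ≤ n := by rw [← hn]; exact_mod_cast Fintype.card_pos
  have hK0 : 0 < (K : ℝ) := (one_div_pos.2 hb).trans_le hK
  have hK1 : (1 : ℝ) ≤ K := by exact_mod_cast Nat.one_le_iff_ne_zero.2 (by rintro rfl; simp at hK0)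
  have hbK : 1 / (K : ℝ) ≤ b := by rw [div_le_iff₀ hK0]; rwa [div_le_iff₀ hb, mul_comm] at hK
  have hk1 : (1 : ℝ) ≤ k := by exact_mod_cast hf.one_le
  set Q := (diff ν μ).normSq with hQ
  have hQ0 : 0 ≤ Q := normSq_nonneg _
  set θ := 1 / invAccuracy K n E with hθ
  have hE0 : 0 < E := by linarith
  have hBE : B * (300 * E) < 1 := by
    rw [← mul_pow] at hclose
    exact (sq_lt_one_iff₀ (by positivity)).1 hclose
  have hB1 : B ≤ 1 / 300 := by nlinarith
  have hM : ∀ σ, |(diff ν μ).energy σ| ≤ B := fun σ => by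
    apply abs_le_of_sq_le_sq _ hB
    rw [hB2]
    refine ((diff ν μ).energy_sq_le σ).trans ?_
    rw [hn]
    gcongr
    linarith
  have hm : |μ.mean (diff ν μ).energy| ≤ B := μ.abs_mean_le hM
  set v := energyVariance ν μ with hv
  have hQ1 : Q ≤ 1 := by nlinarith
  -- the variance is bounded from below in terms of the parameters
  have hvQ : Q / (32 * (K : ℝ) ^ 2 * ((n : ℝ) + 1) ^ 4) ≤ v := by
    have h3 := hμ.mean_energy_ge hb (diff ν μ) (μ.mean (diff ν μ).energy)
    have h4 : μ.mean (fun σ => min 1 (((diff ν μ).energy σ - μ.mean (diff ν μ).energy) ^ 2)) ≤ v :=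
      μ.mean_mono fun σ => min_le_right _ _
    refine le_trans (le_trans ?_ h3) h4
    have h5 : Q / (8 * ((n : ℝ) + 1) ^ 4)
        ≤ min 1 ((diff ν μ).normSq / (8 * (Fintype.card V : ℝ) ^ 4)) := by
      rw [hn, ← hQ]
      apply le_min
      · rw [div_le_one (by positivity)]
        have : (1 : ℝ) ≤ ((n : ℝ) + 1) ^ 4 := one_le_pow₀ (by linarith)
        linarith
      · gcongr
        linarith
    calc Q / (32 * (K : ℝ) ^ 2 * ((n : ℝ) + 1) ^ 4)
        = (1 / (K : ℝ)) ^ 2 / 4 * (Q / (8 * ((n : ℝ) + 1) ^ 4)) := by field_simp; ring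
      _ ≤ _ := by gcongr
  have hv0 : 0 ≤ v := le_trans (by positivity) hvQ
  have hBv : B ^ 2 ≤ 64 * (K : ℝ) ^ 2 * ((n : ℝ) + 1) ^ 6 * v := by
    rw [div_le_iff₀ (by positivity)] at hvQ
    rw [hB2]
    nlinarith [mul_le_mul_of_nonneg_left hvQ (show (0 : ℝ) ≤ 2 * ((n : ℝ) + 1) ^ 2 by positivity)]
  have hθ1 : 256 * (K : ℝ) ^ 2 * ((n : ℝ) + 1) ^ 6 * θ ≤ 1 / (4 * E) := by
    rw [hθ, mul_one_div, div_le_div_iff₀ (by unfold invAccuracy; positivity) (by positivity),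
      invAccuracy]
    have e2 : ((n : ℝ) + 1) ^ 6 ≤ ((n : ℝ) + 1) ^ 8 := pow_le_pow_right₀ (by linarith) (by norm_num)
    have e3 : (K : ℝ) ^ 2 ≤ (K : ℝ) ^ 3 := pow_le_pow_right₀ hK1 (by norm_num)
    have e4 : E ≤ E ^ 3 := le_self_pow₀ hE (by norm_num)
    calc 256 * (K : ℝ) ^ 2 * ((n : ℝ) + 1) ^ 6 * (4 * E)
        = 1024 * (K : ℝ) ^ 2 * ((n : ℝ) + 1) ^ 6 * E := by ring
      _ ≤ 1382400000 * (K : ℝ) ^ 3 * ((n : ℝ) + 1) ^ 8 * E ^ 3 := by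
          gcongr; norm_num
      _ = _ := by ring
  have hθ0 : 0 ≤ θ := by rw [hθ]; unfold invAccuracy; positivity
  have hθ2 : θ ≤ 1 := by
    have : 1 / (4 * E) ≤ 1 := by rw [div_le_one (by positivity)]; linarith
    have h6 : (1 : ℝ) ≤ (K : ℝ) ^ 2 * ((n : ℝ) + 1) ^ 6 :=
      one_le_mul_of_one_le_of_one_le (one_le_pow₀ hK1) (one_le_pow₀ (by linarith))
    nlinarith
  have herr : 4 * (B ^ 2 * θ) ≤ 1 / (4 * E) * v := by
    calc 4 * (B ^ 2 * θ) ≤ 4 * ((64 * (K : ℝ) ^ 2 * ((n : ℝ) + 1) ^ 6 * v) * θ) := by gcongr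
      _ = 256 * (K : ℝ) ^ 2 * ((n : ℝ) + 1) ^ 6 * θ * v := by ring
      _ ≤ _ := by gcongr
  -- the empirical variance is close to the variance
  have hest : |(x₂ - x₁ ^ 2) - v| ≤ 1 / (4 * E) * v := by
    refine le_trans ?_ herr
    set m := μ.mean (diff ν μ).energy with hmdef
    have hBθ : B * θ ≤ B := mul_le_of_le_one_right hB hθ2
    have h3 : |x₁ + m| ≤ 3 * B := by
      have : x₁ + m = (x₁ - m) + 2 * m := by ring
      rw [this]
      refine (abs_add_le _ _).trans ?_
      rw [abs_mul, abs_two]; linarith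
    have h4 : |x₁ ^ 2 - m ^ 2| ≤ 3 * (B ^ 2 * θ) := by
      rw [sq_sub_sq, abs_mul]
      calc |x₁ + m| * |x₁ - m| ≤ 3 * B * (B * θ) := by gcongr
        _ = _ := by ring
    have h5 : (x₂ - x₁ ^ 2) - v
        = (x₂ - μ.mean (fun σ => (diff ν μ).energy σ ^ 2)) - (x₁ ^ 2 - m ^ 2) := by
      rw [hv, energyVariance_eq]; ring
    rw [h5]
    refine (abs_sub _ _).trans ?_
    linarith
  have hDv := abs_fDiv_sub_energyVariance_le ν μ hf hM (by linarith)
  rw [← hv] at hDv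
  set w := v / k with hw
  have hw0 : 0 ≤ w := by positivity
  have h6 : |(x₂ - x₁ ^ 2) / k - w| ≤ 1 / (4 * E) * w := by
    rw [hw, ← sub_div, abs_div, abs_of_pos (show (0 : ℝ) < k by linarith), ← mul_div_assoc]
    gcongr
  have h7 : 75 * B * w ≤ 1 / (4 * E) * w := by
    gcongr
    rw [le_div_iff₀ (by positivity)]; linarith
  have h8 : 1 / (4 * E) * w ≤ 1 / 4 * w := by
    gcongr; linarith
  have h9 : w / 2 ≤ ν.fDiv μ f := by
    have := (abs_le.1 hDv).1
    linarith
  have h10 : 1 / E * (w / 2) ≤ 1 / E * ν.fDiv μ f := by gcongr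
  have h11 : 1 / E * (w / 2) = 1 / (4 * E) * w + 1 / (4 * E) * w := by field_simp; ring
  have h12 := abs_sub_le ((x₂ - x₁ ^ 2) / k) w (ν.fDiv μ f)
  rw [abs_sub_comm w] at h12
  linarith

/-- The bound on the log-likelihood ratio used for models whose parameters are not close. -/
lemma abs_logRatio_le_of_flipBounded (hν : ν.FlipBounded b)
    (hμ : μ.FlipBounded b) (hb : 0 < b) (hK : 1 / b ≤ K) {n : ℕ} (hn : Fintype.card V = n)
    (σ : Config V) : |logRatio ν μ σ| ≤ ((n : ℝ) + 1) ^ 2 * K := by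
  have hL : ∀ v σ, |(diff ν μ).localField v σ| ≤ K := by
    intro v τ
    have h1 := hν.two_mul_localField_le hb v τ
    have h2 := hμ.two_mul_localField_le hb v τ
    have h3 : log (1 / b) ≤ 1 / b := by
      linarith [log_le_sub_one_of_pos (one_div_pos.2 hb)]
    rw [localField_diff]
    refine (abs_sub _ _).trans ?_
    rw [abs_mul, abs_two] at h1 h2
    linarith
  have h := abs_logRatio_le (fun τ => (diff ν μ).abs_energy_le_of_localField hL τ) σ
  refine h.trans ?_
  rw [hn]
  have : (0 : ℝ) ≤ K := Nat.cast_nonneg K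
  nlinarith

/-- Accuracy of the direct estimate, for models whose parameters are not close. -/
lemma abs_direct_estimate_sub_fDiv_le (hf : IsLogGenerator f a c k) [Nonempty V]
    (hμ : μ.FlipBounded b) (hb : 0 < b) (hK : 1 / b ≤ K) (hE : 1 ≤ E) {n : ℕ}
    (hn : Fintype.card V = n)
    (hfar : 1 ≤ 2 * ((n : ℝ) + 1) ^ 2 * (diff ν μ).normSq * (300 * E) ^ 2) {x₁ x₂ y : ℝ}
    (h₁ : |x₁ - ν.mean (fun σ => a (logRatio ν μ σ))|
      ≤ ((n : ℝ) + 1) ^ 2 * K * (1 / invAccuracy K n E))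
    (h₂ : |x₂ - μ.mean (fun σ => c (logRatio ν μ σ))|
      ≤ ((n : ℝ) + 1) ^ 2 * K * (1 / invAccuracy K n E))
    (hy : |y - (x₁ + x₂)| ≤ 1 / invAccuracy K n E) :
    |y - ν.fDiv μ f| ≤ 1 / E * ν.fDiv μ f := by
  have hn1 : (1 : ℝ) ≤ n := by rw [← hn]; exact_mod_cast Fintype.card_pos
  have hK0 : 0 < (K : ℝ) := (one_div_pos.2 hb).trans_le hK
  have hK1 : (1 : ℝ) ≤ K := by exact_mod_cast Nat.one_le_iff_ne_zero.2 (by rintro rfl; simp at hK0)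
  have hbK : 1 / (K : ℝ) ≤ b := by rw [div_le_iff₀ hK0]; rwa [div_le_iff₀ hb, mul_comm] at hK
  have hE0 : 0 < E := by linarith
  set Q := (diff ν μ).normSq with hQ
  set θ := 1 / invAccuracy K n E with hθ
  have hθ0 : 0 ≤ θ := by rw [hθ]; unfold invAccuracy; positivity
  set m := (n : ℝ) + 1 with hm
  have hm1 : 1 ≤ m := by linarith
  have hD : 1 / (460800000 * (K : ℝ) ^ 2 * m ^ 6 * E ^ 2) ≤ ν.fDiv μ f := by
    refine le_trans ?_ (fDiv_ge hf hμ hb)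
    have h5 : 1 / (1440000 * m ^ 6 * E ^ 2)
        ≤ min 1 ((diff ν μ).normSq / (8 * (Fintype.card V : ℝ) ^ 4)) := by
      rw [hn, ← hQ]
      apply le_min
      · rw [div_le_one (by positivity)]
        have : (1 : ℝ) ≤ m ^ 6 * E ^ 2 :=
          one_le_mul_of_one_le_of_one_le (one_le_pow₀ hm1) (one_le_pow₀ hE)
        linarith
      · have hQ2 : 1 / (180000 * m ^ 2 * E ^ 2) ≤ Q := by
          rw [div_le_iff₀ (by positivity)]; linarith
        calc 1 / (1440000 * m ^ 6 * E ^ 2)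
            = 1 / (180000 * m ^ 2 * E ^ 2) / (8 * m ^ 4) := by field_simp; norm_num
          _ ≤ Q / (8 * m ^ 4) := by gcongr
          _ ≤ Q / (8 * (n : ℝ) ^ 4) := by
            have : 0 ≤ Q := normSq_nonneg _
            gcongr; linarith
    calc _ = (1 / (K : ℝ)) ^ 2 / 320 * (1 / (1440000 * m ^ 6 * E ^ 2)) := by
          field_simp; norm_num
      _ ≤ _ := by gcongr
  have herr : 3 * (m ^ 2 * K * θ) ≤ 1 / E * ν.fDiv μ f := by
    calc 3 * (m ^ 2 * K * θ) = 1 / E * (1 / (460800000 * (K : ℝ) ^ 2 * m ^ 6 * E ^ 2)) := by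
          rw [hθ, invAccuracy, ← hm]; field_simp; norm_num
      _ ≤ _ := by gcongr
  refine le_trans ?_ herr
  have h1 : θ ≤ m ^ 2 * K * θ :=
    le_mul_of_one_le_left hθ0 (one_le_mul_of_one_le_of_one_le (one_le_pow₀ hm1) hK1)
  rw [fDiv_eq_mean_add_mean ν μ hf]
  have e : ∀ p q : ℝ, y - (p + q) = (y - (x₁ + x₂)) + (x₁ - p) + (x₂ - q) := fun p q => by ring
  rw [e]
  refine (abs_add_three _ _ _).trans ?_
  linarith

end Accuracy

end IsingModel

/-- A relative error of `1 / (1 + 1 / ε)` is within the factors `exp (± ε)`. -/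
lemma exp_bounds_of_abs_sub_le {ε D y : ℝ} (hε : 0 < ε) (hD : 0 ≤ D)
    (h : |y - D| ≤ 1 / (1 + 1 / ε) * D) : exp (-ε) * D ≤ y ∧ y ≤ exp ε * D := by
  have e : 1 / (1 + 1 / ε) = ε / (1 + ε) := by field_simp; ring
  rw [e] at h
  have h1 := abs_le.1 h
  have h2 : exp (-ε) ≤ 1 - ε / (1 + ε) := by
    have : 1 - ε / (1 + ε) = 1 / (1 + ε) := by field_simp; ring
    rw [this, exp_neg, inv_eq_one_div]
    exact one_div_le_one_div_of_le (by linarith) (by linarith [add_one_le_exp ε])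
  have h3 : 1 + ε / (1 + ε) ≤ exp ε := by
    have : ε / (1 + ε) ≤ ε := div_le_self hε.le (by linarith)
    linarith [add_one_le_exp ε]
  constructor <;> nlinarith

end IsingDiv

/-! ### Empirical means of oracle samples -/

namespace IsingDiv

open MeasureTheory ProbabilityTheory

set_option linter.unusedSectionVars false

section MonteCarlo

variable {Ξ : Type} [MeasurableSpace Ξ] (P : Measure Ξ) [IsProbabilityMeasure P]

instance : IsProbabilityMeasure (sourceLaw P) := by
  unfold sourceLaw; infer_instance

/-- The oracle seed of every draw has law `P`. -/
lemma measurePreserving_seed (i : ℕ) :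
    MeasurePreserving (fun ω : ℕ → Ξ × Bool => (ω i).1) (sourceLaw P) P :=
  measurePreserving_fst.comp (measurePreserving_eval_infinitePi
    (fun _ : ℕ => P.prod (PMF.uniformOfFintype Bool).toMeasure) i)

lemma iIndepFun_seed {ι : ℕ → ℕ} (hι : ι.Injective) {g : Ξ → ℝ} (hg : Measurable g) :
    iIndepFun (fun i (ω : ℕ → Ξ × Bool) => g (ω (ι i)).1) (sourceLaw P) := by
  have := iIndepFun_infinitePi (P := fun _ : ℕ => P.prod (PMF.uniformOfFintype Bool).toMeasure)
    (X := fun _ x => g x.1) (fun _ => hg.comp measurable_fst)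
  exact this.precomp hι

/-- Chebyshev's inequality for the empirical mean of a bounded function of independent seeds. -/
lemma measure_empirical_mean_le {ι : ℕ → ℕ} (hι : ι.Injective) {g : Ξ → ℝ} (hg : Measurable g)
    {B : ℝ} (hB : 0 < B) (hgB : ∀ ξ, |g ξ| ≤ B) {N : ℕ} (hN : 0 < N) {θ : ℝ} (hθ : 0 < θ) :
    sourceLaw P {ω | ¬ |(∑ i ∈ Finset.range N, g (ω (ι i)).1) / N - ∫ ξ, g ξ ∂P| < B * θ}
      ≤ ENNReal.ofReal (1 / (N * θ ^ 2)) := by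
  set X : ℕ → (ℕ → Ξ × Bool) → ℝ := fun i ω => g (ω (ι i)).1 with hX
  have hN' : (0 : ℝ) < N := by exact_mod_cast hN
  have hXm : ∀ i, Measurable (X i) := fun i => hg.comp (measurePreserving_seed P (ι i)).measurable
  have hXL : ∀ i, MemLp (X i) 2 (sourceLaw P) := fun i =>
    MemLp.of_bound (hXm i).aestronglyMeasurable B (Filter.Eventually.of_forall fun ω => hgB _)
  have hXv : ∀ i, variance (X i) (sourceLaw P) ≤ B ^ 2 := fun i => by
    have := variance_le_sq_of_bounded (μ := sourceLaw P) (a := -B) (b := B) (X := X i)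
      (Filter.Eventually.of_forall fun ω => Set.mem_Icc.2 (abs_le.1 (hgB _)))
      (hXm i).aemeasurable
    convert this using 2
    ring
  have hXe : ∀ i, ∫ ω, X i ω ∂(sourceLaw P) = ∫ ξ, g ξ ∂P := fun i => by
    have h := integral_map (μ := sourceLaw P) (measurePreserving_seed P (ι i)).measurable.aemeasurable
      (f := g) hg.aestronglyMeasurable
    rw [(measurePreserving_seed P (ι i)).map_eq] at h
    exact h.symm
  have hS : variance (∑ i ∈ Finset.range N, X i) (sourceLaw P) ≤ N * B ^ 2 := by
    rw [IndepFun.variance_sum (fun i _ => hXL i)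
      (fun i _ j _ hij => (iIndepFun_seed P hι hg).indepFun hij)]
    refine (Finset.sum_le_card_nsmul _ _ _ fun i _ => hXv i).trans (le_of_eq ?_)
    simp
  have hSe : ∫ ω, (∑ i ∈ Finset.range N, X i) ω ∂(sourceLaw P) = N * ∫ ξ, g ξ ∂P := by
    simp only [Finset.sum_apply]
    rw [integral_finsetSum _ fun i _ => (hXL i).integrable one_le_two]
    simp [hXe]
  have hc := meas_ge_le_variance_div_sq (memLp_finsetSum' (Finset.range N) (fun i _ => hXL i))
    (show 0 < N * (B * θ) by positivity)
  rw [hSe] at hc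
  refine (measure_mono fun ω hω => ?_).trans (hc.trans (ENNReal.ofReal_le_ofReal ?_))
  · simp only [Set.mem_ofPred_eq, not_lt] at hω ⊢
    have e : (∑ i ∈ Finset.range N, g (ω (ι i)).1) / N - ∫ ξ, g ξ ∂P
        = ((∑ i ∈ Finset.range N, X i) ω - N * ∫ ξ, g ξ ∂P) / N := by
      rw [Finset.sum_apply, sub_div, mul_div_cancel_left₀ _ hN'.ne']
    rw [e, abs_div, abs_of_pos hN', le_div_iff₀ hN'] at hω
    linarith
  · calc variance (∑ i ∈ Finset.range N, X i) (sourceLaw P) / (N * (B * θ)) ^ 2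
        ≤ N * B ^ 2 / (N * (B * θ)) ^ 2 := by gcongr
      _ = 1 / (N * θ ^ 2) := by field_simp

end MonteCarlo

section Oracle

variable {V : Type} [Fintype V] [DecidableEq V] {G : SimpleGraph V} {I : IsingModel G}
  {Ξ : Type} [MeasurableSpace Ξ] {P : Measure Ξ} [IsProbabilityMeasure P]

lemma SamplingOracle.comp_eq_sum (S : SamplingOracle I P) (δ : ℝ) (g : Config V → ℝ) :
    (fun ξ => g (S.out δ ξ))
      = fun ξ => ∑ σ, Set.indicator {ξ | S.out δ ξ = σ} (fun _ => g σ) ξ := by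
  classical
  funext ξ
  simp [Set.indicator_apply]

lemma SamplingOracle.measurable_comp (S : SamplingOracle I P) {δ : ℝ} (hδ : 0 < δ)
    (g : Config V → ℝ) : Measurable (fun ξ => g (S.out δ ξ)) := by
  rw [S.comp_eq_sum]
  exact Finset.measurable_sum _ fun σ _ => measurable_const.indicator (S.measurable δ hδ σ)

/-- An oracle with error `δ` biases the mean of a function bounded by `B` by at most `2 * δ * B`. -/
lemma SamplingOracle.abs_integral_sub_mean_le (S : SamplingOracle I P) {δ : ℝ} (hδ : 0 < δ)
    {g : Config V → ℝ} {B : ℝ} (hg : ∀ σ, |g σ| ≤ B) :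
    |∫ ξ, g (S.out δ ξ) ∂P - I.mean g| ≤ 2 * δ * B := by
  have hB : 0 ≤ B := (abs_nonneg _).trans (hg (fun _ => 1))
  have e : ∫ ξ, g (S.out δ ξ) ∂P = ∑ σ, P.real {ξ | S.out δ ξ = σ} * g σ := by
    rw [S.comp_eq_sum, integral_finsetSum]
    · refine Finset.sum_congr rfl fun σ _ => ?_
      rw [integral_indicator_const _ (S.measurable δ hδ σ), smul_eq_mul]
    · exact fun σ _ => (integrable_const _).indicator (S.measurable δ hδ σ)
  rw [e, IsingModel.mean, ← Finset.sum_sub_distrib]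
  have h1 := S.tv_le δ hδ
  calc |∑ σ, (P.real {ξ | S.out δ ξ = σ} * g σ - I.gibbs σ * g σ)|
      ≤ ∑ σ, |P.real {ξ | S.out δ ξ = σ} - I.gibbs σ| * B := by
        refine (Finset.abs_sum_le_sum_abs _ _).trans (Finset.sum_le_sum fun σ _ => ?_)
        rw [← sub_mul, abs_mul]
        exact mul_le_mul_of_nonneg_left (hg σ) (abs_nonneg _)
    _ = (∑ σ, |P.real {ξ | S.out δ ξ = σ} - I.gibbs σ|) * B := by rw [Finset.sum_mul]
    _ ≤ 2 * δ * B := by gcongr; linarith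

/-- The empirical mean over `N ≥ 40 * W ^ 2` oracle samples of error `1 / (4 * W)` is within
`B * (1 / W)` of the Gibbs mean, except with probability `1 / 10`. Half of the deviation is the bias
of the oracle, the other half is left to Chebyshev's inequality. -/
lemma SamplingOracle.measure_empirical_mean_le (S : SamplingOracle I P) {ι : ℕ → ℕ}
    (hι : ι.Injective) {g : Config V → ℝ} {B : ℝ} (hB : 0 < B) (hg : ∀ σ, |g σ| ≤ B)
    {W : ℝ} (hW : 0 < W) {N : ℕ} (hN : 40 * W ^ 2 ≤ N) :
    sourceLaw P {ω | ¬ |(∑ i ∈ Finset.range N, g (S.out (1 / (4 * W)) (ω (ι i)).1)) / N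
      - I.mean g| ≤ B * (1 / W)} ≤ ENNReal.ofReal (1 / 10) := by
  have hN' : (0 : ℝ) < N := lt_of_lt_of_le (by positivity) hN
  have hδ : 0 < 1 / (4 * W) := by positivity
  have h1 := IsingDiv.measure_empirical_mean_le P hι (S.measurable_comp hδ g) hB (fun ξ => hg _)
    (by exact_mod_cast hN') (θ := 1 / (2 * W)) (by positivity)
  refine (measure_mono fun ω hω => ?_).trans (h1.trans (ENNReal.ofReal_le_ofReal ?_))
  · refine fun hlt => hω ?_
    have h2 := S.abs_integral_sub_mean_le hδ hg
    have e : 2 * (1 / (4 * W)) * B + B * (1 / (2 * W)) = B * (1 / W) := by field_simp; norm_num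
    have h3 := abs_sub_le ((∑ i ∈ Finset.range N, g (S.out (1 / (4 * W)) (ω (ι i)).1)) / N)
      (∫ ξ, g (S.out (1 / (4 * W)) ξ) ∂P) (I.mean g)
    linarith
  · rw [div_le_div_iff₀ (by positivity) (by norm_num), one_mul, one_mul, div_pow, one_pow,
      mul_one_div, le_div_iff₀ (by positivity)]
    linarith

/-- The answer of a counting oracle is accurate in logarithmic scale, except with probability
`1 / 100`. -/
lemma CountingOracle.measure_log_le (C : CountingOracle I P) {δ : ℝ} (hδ : 0 < δ) (i : ℕ) :
    sourceLaw P {ω | ¬ |Real.log (C.out δ (ω i).1) - Real.log I.Z| ≤ δ}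
      ≤ ENNReal.ofReal (1 / 100) := by
  set A : Set Ξ := {ξ | Real.exp (-δ) * I.Z ≤ C.out δ ξ ∧ C.out δ ξ ≤ Real.exp δ * I.Z} with hA
  have hAm : MeasurableSet A :=
    (measurableSet_le measurable_const (C.measurable δ hδ)).inter
      (measurableSet_le (C.measurable δ hδ) measurable_const)
  have h1 : P Aᶜ ≤ ENNReal.ofReal (1 / 100) := by
    rw [← ofReal_measureReal]
    apply ENNReal.ofReal_le_ofReal
    rw [probReal_compl_eq_one_sub hAm]
    have := C.accurate δ hδ
    rw [← hA] at this
    norm_num at this ⊢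
    linarith
  rw [← (measurePreserving_seed P i).measure_preimage hAm.compl.nullMeasurableSet] at h1
  refine (measure_mono fun ω hω => ?_).trans h1
  refine fun hmem => hω ?_
  obtain ⟨h2, h3⟩ := hmem
  have hZ := I.Z_pos
  have h0 : 0 < C.out δ (ω i).1 := lt_of_lt_of_le (by positivity) h2
  have h4 := Real.log_le_log (by positivity) h2
  have h5 := Real.log_le_log h0 h3
  rw [Real.log_mul (Real.exp_pos _).ne' hZ.ne', Real.log_exp] at h4 h5
  rw [abs_le]
  constructor <;> linarith

end Oracle

end IsingDiv

/-! ### Total correctness of commands -/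

namespace IsingDiv

set_option linter.unusedSectionVars false

section Halting

variable {n : ℕ} {G : SimpleGraph (Fin n)} {ν μ : IsingModel G} {Ξ : Type}
    [MeasurableSpace Ξ] {P : MeasureTheory.Measure Ξ} {O : Oracles ν μ P} {ω : ℕ → Ξ × Bool}

/-- Total correctness: started in `s`, the command `c` halts within time `T` in a state
satisfying `Q`. -/
def Halts (O : Oracles ν μ P) (ω : ℕ → Ξ × Bool) (c : Cmd) (s : State) (T : ℝ)
    (Q : State → Prop) : Prop :=
  ∃ t s', Exec O ω c s t s' ∧ t ≤ T ∧ Q s'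

lemma Halts.mono {c : Cmd} {s : State} {T T' : ℝ} {Q R : State → Prop}
    (h : Halts O ω c s T Q) (hT : T ≤ T') (hQ : ∀ s', Q s' → R s') : Halts O ω c s T' R := by
  obtain ⟨t, s', h1, h2, h3⟩ := h
  exact ⟨t, s', h1, h2.trans hT, hQ s' h3⟩

lemma Halts.seq {c d : Cmd} {s : State} {T T' : ℝ} {Q R : State → Prop}
    (h : Halts O ω c s T Q) (h' : ∀ s', Q s' → Halts O ω d s' T' R) :
    Halts O ω (.seq c d) s (T + T') R := by
  obtain ⟨t, s', h1, h2, h3⟩ := h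
  obtain ⟨t', s'', h4, h5, h6⟩ := h' s' h3
  exact ⟨_, s'', .seq h1 h4, add_le_add h2 h5, h6⟩

lemma Halts.setN {s : State} {x : ℕ} {e : NExp} {Q : State → Prop}
    (h : Q (s.setN x (e.eval s))) : Halts O ω (.setN x e) s (1 + e.size) Q :=
  ⟨_, _, .setN s x e, le_rfl, h⟩

lemma Halts.setR {s : State} {a : ℕ} {i j : NExp} {e : RExp} {Q : State → Prop}
    (h : Q (s.setR a (i.eval s) (j.eval s) (e.eval s))) :
    Halts O ω (.setR a i j e) s (1 + i.size + j.size + e.size) Q :=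
  ⟨_, _, .setR s a i j e, le_rfl, h⟩

lemma Halts.ite {b : BExp} {c d : Cmd} {s : State} {T : ℝ} {Q : State → Prop}
    (hc : b.eval s → Halts O ω c s T Q) (hd : ¬ b.eval s → Halts O ω d s T Q) :
    Halts O ω (.ite b c d) s (1 + b.size + T) Q := by
  by_cases hb : b.eval s
  · obtain ⟨t, s', h1, h2, h3⟩ := hc hb
    exact ⟨_, s', .ite_true hb h1, by gcongr, h3⟩
  · obtain ⟨t, s', h1, h2, h3⟩ := hd hb
    exact ⟨_, s', .ite_false hb h1, by gcongr, h3⟩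

/-- A loop whose body steps an invariant `Inv 0, Inv 1, …` and whose test fails exactly at
`Inv K`. -/
lemma Halts.loop {b : BExp} {c : Cmd} {K : ℕ} {T : ℝ} {Inv : ℕ → State → Prop} {s : State}
    (hstep : ∀ k < K, ∀ s, Inv k s → b.eval s ∧ Halts O ω c s T (Inv (k + 1)))
    (hend : ∀ s, Inv K s → ¬ b.eval s) (h0 : Inv 0 s) :
    Halts O ω (.loop b c) s (K * (1 + b.size + T) + (1 + b.size)) (Inv K) := by
  have key : ∀ j ≤ K, ∀ s, Inv (K - j) s →
      Halts O ω (.loop b c) s (j * (1 + b.size + T) + (1 + b.size)) (Inv K) := by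
    intro j
    induction j with
    | zero =>
      intro _ s hs
      exact ⟨_, s, .loop_false (hend s (by simpa using hs)), by simp, by simpa using hs⟩
    | succ j ih =>
      intro hj s hs
      obtain ⟨hb, t, s', h1, h2, h3⟩ := hstep (K - (j + 1)) (by omega) s hs
      rw [show K - (j + 1) + 1 = K - j by omega] at h3
      obtain ⟨t', s'', h4, h5, h6⟩ := ih (by omega) s' h3
      refine ⟨_, s'', .loop_true hb h1 h4, ?_, h6⟩
      push_cast
      linarith
  exact key K le_rfl s (by simpa using h0)

end Halting

/-! ### The program -/

/-- The expression `e ^ k`. -/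
def RExp.npow (e : RExp) : ℕ → RExp
  | 0 => .lit 1
  | k + 1 => .mul (e.npow k) e

lemma RExp.eval_npow (s : State) (e : RExp) (k : ℕ) : (e.npow k).eval s = e.eval s ^ k := by
  induction k with
  | zero => simp [npow, eval]
  | succ k ih => simp [npow, eval, ih, pow_succ]

/-- The scalar variable kept in the entry `(0, 0)` of array `a`. -/
def RExp.var (a : ℕ) : RExp := .get a (.lit 0) (.lit 0)

/-- `a += e` for a scalar variable `a`. -/
def Cmd.addTo (a : ℕ) (e : RExp) : Cmd := .setR a (.lit 0) (.lit 0) (.add (.var a) e)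

/-- `out := ∑ i < n, ∑ j < n, e`, where `e` reads `i` and `j` from the registers `1` and `2`, and
`n` is in register `0`. -/
def Cmd.doubleSum (out : ℕ) (e : RExp) : Cmd :=
  .seq (.setR out (.lit 0) (.lit 0) (.lit 0)) <| .seq (.setN 1 (.lit 0)) <|
    .loop (.nlt (.reg 1) (.reg 0)) <| .seq (.setN 2 (.lit 0)) <|
      .seq (.loop (.nlt (.reg 2) (.reg 0))
        (.seq (.addTo out e) (.setN 2 (.add (.reg 2) (.lit 1)))))
        (.setN 1 (.add (.reg 1) (.lit 1)))

/-- The difference of the entries `(i, j)` of the arrays `a` and `a'`. -/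
def entryDiff (a a' : ℕ) : RExp := .sub (.get a (.reg 1) (.reg 2)) (.get a' (.reg 1) (.reg 2))

/-- The summand of the squared parameter distance. -/
def normTerm : RExp := .add ((entryDiff 1 3).npow 2) ((entryDiff 2 4).npow 2)

/-- The summand of the energy difference of the configuration in array `7`. The field arrays are
zero outside column `0`, so that the double sum picks up every external field once. -/
def energyTerm : RExp :=
  .add (.mul (.div (.lit 1) (.lit 2)) (.mul (.mul (entryDiff 1 3) (.get 7 (.reg 1) (.lit 0)))
    (.get 7 (.reg 2) (.lit 0))))
    (.mul (entryDiff 2 4) (.get 7 (.reg 1) (.lit 0)))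

/-- `1 + 1 / ε`. -/
def invErrorExp : RExp := .add (.lit 1) (.div (.lit 1) (.var 5))

/-- `n + 1`. -/
def sizeExp : RExp := .add (.ofNat (.reg 0)) (.lit 1)

/-- `invAccuracy K n (1 + 1 / ε)`. -/
def invAccuracyExp (K : ℕ) : RExp :=
  .mul (.mul (.mul (.lit 1382400000) ((RExp.lit K).npow 3)) (sizeExp.npow 8)) (invErrorExp.npow 3)

/-- The error bound of all oracle calls. -/
def oracleErrorExp (K : ℕ) : RExp := .div (.lit 1) (.mul (.lit 4) (invAccuracyExp K))

/-- Sample from model `w` and store the energy difference of the sample in `out`. -/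
def sampleEnergy (K : ℕ) (w : Which) (out : ℕ) : Cmd :=
  .seq (.sample w (oracleErrorExp K) 7) (.doubleSum out energyTerm)

/-- The estimated log-likelihood ratio for the energy difference in `out`; the estimates of the
two partition functions are in `8` and `9`. -/
def logRatioExp (out : ℕ) : RExp := .add (.sub (.var out) (.log (.var 8))) (.log (.var 9))

/-- Draw a sample from each model and update the direct estimator (in `13`) and the first two
empirical moments (in `14` and `15`). -/
def drawStep (K : ℕ) (aE cE : RExp → RExp) : Cmd :=
  .seq (sampleEnergy K .first 11) <| .seq (sampleEnergy K .second 12) <|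
    .seq (.addTo 13 (.add (aE (logRatioExp 11)) (cE (logRatioExp 12)))) <|
      .seq (.addTo 14 (.var 12)) <| .seq (.addTo 15 ((RExp.var 12).npow 2))
        (.setN 3 (.add (.reg 3) (.lit 1)))

/-- The test for close parameters; the squared parameter distance is in `10`. It ensures that all
energy differences are at most `1 / (300 * E)` with `E = 1 + 1 / ε`, which makes the relative error
`75 / (300 * E)` of the variance approximation at most `1 / (4 * E)`. -/
def closeTest : BExp :=
  .rlt (.mul (.mul (.mul (.lit 2) (sizeExp.npow 2)) (.var 10))
    ((RExp.mul (.lit 300) invErrorExp).npow 2)) (.lit 1)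

/-- `out / N`, where the number `N` of draws is in register `3`. -/
def averageExp (out : ℕ) : RExp := .div (.var out) (.ofNat (.reg 3))

/-- `1 / k` times the empirical variance. -/
def varianceExp (k : ℕ) : RExp :=
  .div (.sub (averageExp 15) ((averageExp 14).npow 2)) (.lit k)

/-- Write the empirical variance or the direct estimate to the output. -/
def writeOutput (k : ℕ) : Cmd :=
  .ite closeTest (.setR 6 (.lit 0) (.lit 0) (varianceExp k))
    (.setR 6 (.lit 0) (.lit 0) (averageExp 13))

/-- The test for fewer than `40 * W ^ 2` draws, where `W` is the inverse accuracy. -/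
def drawTest (K : ℕ) : BExp := .rlt (.ofNat (.reg 3)) (.mul (.lit 40) ((invAccuracyExp K).npow 2))

/-- The approximation algorithm: `K ≥ 1 / b`, and `aE`, `cE` and `k` describe the divergence
generator as in `IsLogGenerator`. -/
def divergenceProgram (K k : ℕ) (aE cE : RExp → RExp) : Cmd :=
  .seq (.count .first (oracleErrorExp K) 8) <| .seq (.count .second (oracleErrorExp K) 9) <|
    .seq (.doubleSum 10 normTerm) <| .seq (.loop (drawTest K) (drawStep K aE cE)) (writeOutput k)

/-! ### Running time and effect of the subroutines -/

/-- The running time of a double sum with a summand of size `z`. -/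
def doubleSumCost (z n : ℕ) : ℝ := (n : ℝ) * (n * (z + 15) + 14) + 10

section Subroutines

variable {n : ℕ} {G : SimpleGraph (Fin n)} {ν μ : IsingModel G} {Ξ : Type}
    [MeasurableSpace Ξ] {P : MeasureTheory.Measure Ξ} {O : Oracles ν μ P} {ω : ℕ → Ξ × Bool}

lemma Halts.addTo {s : State} {a : ℕ} {e : RExp} {Q : State → Prop}
    (h : Q (s.setR a 0 0 (s.real a 0 0 + e.eval s))) :
    Halts O ω (.addTo a e) s (e.size + 7) Q :=
  (Halts.setR (i := .lit 0) (j := .lit 0) (e := .add (.var a) e) h).mono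
    (by simp only [NExp.size, RExp.size, RExp.var]; push_cast; linarith) fun _ h => h

lemma State.setR_real_self (s : State) (a i j : ℕ) (r : ℝ) : (s.setR a i j r).real a i j = r := by
  simp [State.setR]

lemma State.setR_real_of_ne (s : State) {a a' : ℕ} (i j : ℕ) (r : ℝ) (h : a' ≠ a) :
    (s.setR a i j r).real a' = s.real a' := by
  funext i' j'; simp [State.setR, h]

lemma Halts.doubleSum {s : State} {out : ℕ} {e : RExp} (F : ℕ → ℕ → ℝ)
    (hF : ∀ i j s', s'.nat 1 = i → s'.nat 2 = j → (∀ a, a ≠ out → s'.real a = s.real a) →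
      e.eval s' = F i j) :
    Halts O ω (.doubleSum out e) s (doubleSumCost e.size (s.nat 0)) fun s' =>
      (∀ x, x ≠ 1 → x ≠ 2 → s'.nat x = s.nat x) ∧ (∀ a, a ≠ out → s'.real a = s.real a) ∧
      s'.real out 0 0 = ∑ i ∈ Finset.range (s.nat 0), ∑ j ∈ Finset.range (s.nat 0), F i j ∧
      s'.draws = s.draws := by
  set N := s.nat 0 with hN
  set Frame : State → Prop := fun s' => (∀ x, x ≠ 1 → x ≠ 2 → s'.nat x = s.nat x) ∧
    (∀ a, a ≠ out → s'.real a = s.real a) ∧ s'.draws = s.draws with hFrame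
  have frame_setN1 : ∀ s' k, Frame s' → Frame (s'.setN 1 k) := fun s' k h =>
    ⟨fun x h1 h2 => by simp [State.setN, h1, h.1 x h1 h2], h.2.1, h.2.2⟩
  have frame_setN2 : ∀ s' k, Frame s' → Frame (s'.setN 2 k) := fun s' k h =>
    ⟨fun x h1 h2 => by simp [State.setN, h2, h.1 x h1 h2], h.2.1, h.2.2⟩
  have frame_setR : ∀ s' r, Frame s' → Frame (s'.setR out 0 0 r) := fun s' r h =>
    ⟨h.1, fun a ha => (s'.setR_real_of_ne 0 0 r ha).trans (h.2.1 a ha), h.2.2⟩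
  set Inner : ℕ → ℝ → ℕ → State → Prop := fun i S j s' =>
    Frame s' ∧ s'.nat 1 = i ∧ s'.nat 2 = j ∧
      s'.real out 0 0 = S + ∑ j ∈ Finset.range j, F i j with hInner
  set Outer : ℕ → State → Prop := fun i s' =>
    Frame s' ∧ s'.nat 1 = i ∧
      s'.real out 0 0 = ∑ i ∈ Finset.range i, ∑ j ∈ Finset.range N, F i j with hOuter
  have nat0 : ∀ s', Frame s' → s'.nat 0 = N := fun s' h => h.1 0 (by norm_num) (by norm_num)
  have inner : ∀ i S s', Inner i S 0 s' → Halts O ω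
      (.loop (.nlt (.reg 2) (.reg 0)) (.seq (.addTo out e) (.setN 2 (.add (.reg 2) (.lit 1)))))
      s' (N * (1 + (3 : ℕ) + ((e.size + 7) + 4)) + (1 + (3 : ℕ))) (Inner i S N) := by
    intro i S s' h0
    refine Halts.loop (b := .nlt (.reg 2) (.reg 0)) ?_ ?_ h0
    · rintro j hj s1 ⟨hf, h1, h2, h3⟩
      refine ⟨by simp only [BExp.eval, NExp.eval, h2, nat0 s1 hf]; exact hj, ?_⟩
      refine Halts.seq (Q := fun s2 => Frame s2 ∧ s2.nat 1 = i ∧ s2.nat 2 = j ∧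
        s2.real out 0 0 = S + ∑ j ∈ Finset.range (j + 1), F i j) (Halts.addTo ?_) ?_
      · refine ⟨frame_setR _ _ hf, h1, h2, ?_⟩
        rw [State.setR_real_self, h3, Finset.sum_range_succ, hF i j s1 h1 h2 hf.2.1, add_assoc]
      · rintro s2 ⟨hf2, h4, h5, h6⟩
        refine (Halts.setN (Q := Inner i S (j + 1)) ?_).mono (by simp [NExp.size]; norm_num)
          fun _ h => h
        exact ⟨frame_setN2 _ _ hf2, by simp [State.setN, h4],
          by simp [State.setN, NExp.eval, h5], h6⟩
    · rintro s1 ⟨hf, h1, h2, h3⟩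
      simp [BExp.eval, NExp.eval, h2, nat0 s1 hf]
  have outer : ∀ s', Outer 0 s' → Halts O ω
      (.loop (.nlt (.reg 1) (.reg 0)) <| .seq (.setN 2 (.lit 0)) <|
        .seq (.loop (.nlt (.reg 2) (.reg 0))
          (.seq (.addTo out e) (.setN 2 (.add (.reg 2) (.lit 1)))))
          (.setN 1 (.add (.reg 1) (.lit 1))))
      s' (N * (1 + (3 : ℕ) + (2 + ((N * (1 + (3 : ℕ) + ((e.size + 7) + 4)) + (1 + (3 : ℕ))) + 4)))
        + (1 + (3 : ℕ))) (Outer N) := by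
    intro s' h0
    refine Halts.loop (b := .nlt (.reg 1) (.reg 0)) ?_ ?_ h0
    · rintro i hi s1 ⟨hf, h1, h3⟩
      refine ⟨by simp only [BExp.eval, NExp.eval, h1, nat0 s1 hf]; exact hi, ?_⟩
      refine Halts.seq (Q := Inner i (∑ i ∈ Finset.range i, ∑ j ∈ Finset.range N, F i j) 0)
        ((Halts.setN ?_).mono (by simp [NExp.size]; norm_num) fun _ h => h) fun s2 h2 => ?_
      · exact ⟨frame_setN2 _ _ hf, by simp [State.setN, h1],
          by simp [State.setN, NExp.eval], by simpa [State.setN] using h3⟩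
      refine Halts.seq (inner i _ s2 h2) fun s3 h4 => ?_
      refine (Halts.setN (Q := Outer (i + 1)) ?_).mono (by simp [NExp.size]; norm_num)
        fun _ h => h
      obtain ⟨hf3, h5, h6, h7⟩ := h4
      refine ⟨frame_setN1 _ _ hf3, by simp [State.setN, NExp.eval, h5], ?_⟩
      rw [Finset.sum_range_succ, ← h7]
      rfl
    · rintro s1 ⟨hf, h1, h3⟩
      simp [BExp.eval, NExp.eval, h1, nat0 s1 hf]
  have hf0 : Frame s := ⟨fun _ _ _ => rfl, fun _ _ => rfl, rfl⟩
  have main : Halts O ω (.doubleSum out e) s _ (Outer N) :=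
    Halts.seq (Q := fun s1 => Frame s1 ∧ s1.real out 0 0 = 0)
      (Halts.setR (i := .lit 0) (j := .lit 0) (e := .lit 0)
        ⟨frame_setR _ _ hf0, by simp [State.setR, RExp.eval, NExp.eval]⟩)
      fun s1 h1 => Halts.seq (Q := Outer 0)
        (Halts.setN (e := .lit 0) ⟨frame_setN1 _ _ h1.1, by simp [State.setN, NExp.eval],
          by simpa [State.setN] using h1.2⟩)
        fun s2 h2 => outer s2 h2
  refine main.mono (le_of_eq ?_) fun s' h => ⟨h.1.1, h.1.2.1, h.2.2, h.1.2.2⟩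
  simp only [NExp.size, RExp.size, doubleSumCost]
  push_cast
  ring

end Subroutines

end IsingDiv

/-! ### Execution of the program -/

namespace IsingDiv

set_option linter.unusedSectionVars false

section Execution

variable {n : ℕ} {G : SimpleGraph (Fin n)} {ν μ : IsingModel G} {Ξ : Type}
    [MeasurableSpace Ξ] {P : MeasureTheory.Measure Ξ} {O : Oracles ν μ P} {ω : ℕ → Ξ × Bool}
    {ε : ℝ} {K k : ℕ} {aE cE : RExp → RExp} {a c : ℝ → ℝ} {T : ℝ}

/-- The memory still holds the input. -/
def HasInput (ν μ : IsingModel G) (ε : ℝ) (s : State) : Prop :=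
  s.nat 0 = n ∧ ∀ a ≤ 5, s.real a = (inputState ν μ ε).real a

lemma inputState_J_first (i j : Fin n) : (inputState ν μ ε).real 1 i j = ν.J i j := by
  simp [inputState]

lemma inputState_J_second (i j : Fin n) : (inputState ν μ ε).real 3 i j = μ.J i j := by
  simp [inputState]

lemma inputState_h_first (i j : Fin n) :
    (inputState ν μ ε).real 2 i j = if (j : ℕ) = 0 then ν.h i else 0 := by
  simp [inputState]

lemma inputState_h_second (i j : Fin n) :
    (inputState ν μ ε).real 4 i j = if (j : ℕ) = 0 then μ.h i else 0 := by
  simp [inputState]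

lemma inputState_error : (inputState ν μ ε).real 5 0 0 = ε := by
  simp only [inputState]
  split <;> simp

lemma HasInput.congr {s s' : State} (h : HasInput ν μ ε s) (hn : s'.nat 0 = s.nat 0)
    (hr : ∀ a ≤ 5, s'.real a = s.real a) : HasInput ν μ ε s' :=
  ⟨hn.trans h.1, fun a ha => (hr a ha).trans (h.2 a ha)⟩

lemma HasInput.eval_size {s : State} (h : HasInput ν μ ε s) : sizeExp.eval s = (n : ℝ) + 1 := by
  simp [sizeExp, RExp.eval, NExp.eval, h.1]

lemma HasInput.eval_invError {s : State} (h : HasInput ν μ ε s) :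
    invErrorExp.eval s = 1 + 1 / ε := by
  simp [invErrorExp, RExp.eval, RExp.var, NExp.eval, h.2 5 le_rfl, inputState_error]

lemma HasInput.eval_invAccuracy {s : State} (h : HasInput ν μ ε s) :
    (invAccuracyExp K).eval s = invAccuracy K n (1 + 1 / ε) := by
  simp [invAccuracyExp, RExp.eval, RExp.eval_npow, h.eval_size, h.eval_invError, invAccuracy]

lemma HasInput.eval_oracleError {s : State} (h : HasInput ν μ ε s) :
    (oracleErrorExp K).eval s = 1 / (4 * invAccuracy K n (1 + 1 / ε)) := by
  simp only [oracleErrorExp, RExp.eval, h.eval_invAccuracy]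
  push_cast; rfl

/-- A sum over the entries of column `0`. -/
lemma sum_ite_val_eq_zero (i : Fin n) (x : ℝ) :
    ∑ j : Fin n, (if (j : ℕ) = 0 then x else 0) = x := by
  rw [Finset.sum_eq_single ⟨0, i.pos⟩]
  · simp
  · intro j _ hj
    rw [if_neg fun h => hj (Fin.ext h)]
  · simp

lemma Halts.norm {s : State} (h : HasInput ν μ ε s) :
    Halts O ω (.doubleSum 10 normTerm) s (doubleSumCost normTerm.size n) fun s' =>
      (∀ x, x ≠ 1 → x ≠ 2 → s'.nat x = s.nat x) ∧ (∀ a, a ≠ 10 → s'.real a = s.real a) ∧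
      s'.real 10 0 0 = (IsingModel.diff ν μ).normSq ∧ s'.draws = s.draws := by
  set r := (inputState ν μ ε).real with hr
  have h0 := Halts.doubleSum (O := O) (ω := ω) (s := s) (out := 10) (e := normTerm)
    (fun i j => (r 1 i j - r 3 i j) ^ 2 + (r 2 i j - r 4 i j) ^ 2) (by
      intro i j s' hi hj ha
      simp [normTerm, entryDiff, RExp.eval, RExp.eval_npow, NExp.eval, hi, hj, ha, h.2, hr])
  rw [h.1] at h0
  refine h0.mono le_rfl fun s' ⟨h1, h2, h3, h4⟩ => ⟨h1, h2, ?_, h4⟩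
  rw [h3, Finset.sum_range, IsingModel.normSq, ← Finset.sum_add_distrib]
  refine Finset.sum_congr rfl fun i _ => ?_
  rw [Finset.sum_range, Finset.sum_add_distrib]
  congr 1
  · simp [hr, inputState_J_first, inputState_J_second, IsingModel.diff]
  · rw [← sum_ite_val_eq_zero i ((IsingModel.diff ν μ).h i ^ 2)]
    refine Finset.sum_congr rfl fun j _ => ?_
    rw [hr, inputState_h_first, inputState_h_second]
    split <;> simp [IsingModel.diff]

lemma Halts.energy {s : State} (h : HasInput ν μ ε s) {out : ℕ} (hout : 7 < out)
    {σ : Config (Fin n)} (hσ : ∀ i : Fin n, s.real 7 i 0 = spin σ i) :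
    Halts O ω (.doubleSum out energyTerm) s (doubleSumCost energyTerm.size n) fun s' =>
      (∀ x, x ≠ 1 → x ≠ 2 → s'.nat x = s.nat x) ∧ (∀ a, a ≠ out → s'.real a = s.real a) ∧
      s'.real out 0 0 = (IsingModel.diff ν μ).energy σ ∧ s'.draws = s.draws := by
  set r := (inputState ν μ ε).real with hr
  have h0 := Halts.doubleSum (O := O) (ω := ω) (s := s) (out := out) (e := energyTerm)
    (fun i j => 1 / 2 * ((r 1 i j - r 3 i j) * s.real 7 i 0 * s.real 7 j 0)
      + (r 2 i j - r 4 i j) * s.real 7 i 0) (by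
      intro i j s' hi hj ha
      have h7 : ∀ a, a ≤ 7 → s'.real a = s.real a := fun a ha' => ha a (by omega)
      simp [energyTerm, entryDiff, RExp.eval, NExp.eval, hi, hj, h7, h.2, hr])
  rw [h.1] at h0
  refine h0.mono le_rfl fun s' ⟨h1, h2, h3, h4⟩ => ⟨h1, h2, ?_, h4⟩
  rw [h3, Finset.sum_range, IsingModel.energy, dotProduct, dotProduct, Finset.mul_sum,
    ← Finset.sum_add_distrib]
  refine Finset.sum_congr rfl fun i _ => ?_
  rw [Finset.sum_range, Finset.sum_add_distrib]
  congr 1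
  · rw [Matrix.mulVec, dotProduct, Finset.mul_sum, Finset.mul_sum]
    refine Finset.sum_congr rfl fun j _ => ?_
    rw [hσ, hσ, hr, inputState_J_first, inputState_J_second]
    simp only [IsingModel.diff, Matrix.sub_apply]
    ring
  · rw [← Finset.sum_mul, hσ]
    congr 1
    rw [← sum_ite_val_eq_zero i ((IsingModel.diff ν μ).h i)]
    refine Finset.sum_congr rfl fun j _ => ?_
    rw [hr, inputState_h_first, inputState_h_second]
    split <;> simp [IsingModel.diff]

/-- The common error bound of the oracle calls. -/
noncomputable def oracleError (K n : ℕ) (ε : ℝ) : ℝ := 1 / (4 * invAccuracy K n (1 + 1 / ε))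

lemma Halts.sampleEnergy {s : State} (h : HasInput ν μ ε s) {out : ℕ} (hout : 7 < out) (w : Which)
    (hT : O.sampleCost w (oracleError K n ε) ≤ T) :
    Halts O ω (sampleEnergy K w out) s
      (1 + (oracleErrorExp K).size + T + doubleSumCost energyTerm.size n) fun s' =>
      (∀ x, x ≠ 1 → x ≠ 2 → s'.nat x = s.nat x) ∧
      (∀ a, a ≠ 7 → a ≠ out → s'.real a = s.real a) ∧
      s'.real out 0 0 = (IsingModel.diff ν μ).energy
        (O.sample w (oracleError K n ε) (ω s.draws).1) ∧ s'.draws = s.draws + 1 := by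
  set σ := O.sample w (oracleError K n ε) (ω s.draws).1 with hσ
  have e := h.eval_oracleError (K := K)
  refine Halts.seq (Q := fun s1 => s1 = (s.setConfig 7 σ).draw)
    ⟨_, _, .sample s w (oracleErrorExp K) 7, ?_, ?_⟩ ?_
  · rw [e]; gcongr; exact hT
  · rw [e]; rfl
  · rintro s1 rfl
    have h7 : ∀ a, a ≠ 7 → (s.setConfig 7 σ).draw.real a = s.real a := fun a ha => by
      funext i j; simp [State.draw, State.setConfig, ha]
    have h' : HasInput ν μ ε (s.setConfig 7 σ).draw :=
      h.congr rfl fun a ha => h7 a (by omega)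
    refine (Halts.energy h' hout (σ := σ) fun i => ?_).mono le_rfl fun s' ⟨h1, h2, h3, h4⟩ =>
      ⟨h1, fun a ha ha' => (h2 a ha').trans (h7 a ha), h3, h4⟩
    simp [State.draw, State.setConfig]

/-- The energy difference of the `i`-th sample from `ν`. -/
noncomputable def energyFirst (O : Oracles ν μ P) (δ : ℝ) (ω : ℕ → Ξ × Bool) (i : ℕ) : ℝ :=
  (IsingModel.diff ν μ).energy (O.sample .first δ (ω (2 + 2 * i)).1)

/-- The energy difference of the `i`-th sample from `μ`. -/
noncomputable def energySecond (O : Oracles ν μ P) (δ : ℝ) (ω : ℕ → Ξ × Bool) (i : ℕ) : ℝ :=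
  (IsingModel.diff ν μ).energy (O.sample .second δ (ω (3 + 2 * i)).1)

/-- The estimate of `log (ν.Z / μ.Z)` by the counting oracles. -/
noncomputable def logZEstimate (O : Oracles ν μ P) (δ : ℝ) (ω : ℕ → Ξ × Bool) : ℝ :=
  Real.log (O.count .first δ (ω 0).1) - Real.log (O.count .second δ (ω 1).1)

/-- The sum behind the direct estimator. -/
noncomputable def directSum (O : Oracles ν μ P) (a c : ℝ → ℝ) (δ : ℝ) (ω : ℕ → Ξ × Bool)
    (N : ℕ) : ℝ :=
  ∑ i ∈ Finset.range N, (a (energyFirst O δ ω i - logZEstimate O δ ω)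
    + c (energySecond O δ ω i - logZEstimate O δ ω))

/-- The memory after `i` draws from each model. -/
def DrawInv (O : Oracles ν μ P) (ω : ℕ → Ξ × Bool) (ε : ℝ) (a c : ℝ → ℝ) (δ : ℝ) (i : ℕ)
    (s : State) : Prop :=
  HasInput ν μ ε s ∧ s.nat 3 = i ∧ s.draws = 2 + 2 * i ∧
  s.real 8 0 0 = O.count .first δ (ω 0).1 ∧ s.real 9 0 0 = O.count .second δ (ω 1).1 ∧
  s.real 10 0 0 = (IsingModel.diff ν μ).normSq ∧
  s.real 13 0 0 = directSum O a c δ ω i ∧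
  s.real 14 0 0 = ∑ i ∈ Finset.range i, energySecond O δ ω i ∧
  s.real 15 0 0 = ∑ i ∈ Finset.range i, energySecond O δ ω i ^ 2

/-- The running time of a draw from both models, if each oracle call takes time at most `T`. -/
def drawCost (K : ℕ) (aE cE : RExp → RExp) (n : ℕ) (T : ℝ) : ℝ :=
  (1 + (oracleErrorExp K).size + T + doubleSumCost energyTerm.size n)
    + ((1 + (oracleErrorExp K).size + T + doubleSumCost energyTerm.size n)
      + (((RExp.add (aE (logRatioExp 11)) (cE (logRatioExp 12))).size + 7)
        + (((RExp.var 12).size + 7)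
          + ((((RExp.var 12).npow 2).size + 7)
            + (1 + (NExp.add (.reg 3) (.lit 1)).size)))))

lemma Halts.drawStep (ha : ∀ s e, (aE e).eval s = a (e.eval s))
    (hc : ∀ s e, (cE e).eval s = c (e.eval s)) {s : State} {i : ℕ}
    (hs : DrawInv O ω ε a c (oracleError K n ε) i s)
    (hT : ∀ w, O.sampleCost w (oracleError K n ε) ≤ T) :
    Halts O ω (drawStep K aE cE) s (drawCost K aE cE n T)
      (DrawInv O ω ε a c (oracleError K n ε) (i + 1)) := by
  set δ := oracleError K n ε with hδ
  obtain ⟨hin, h3, hd, h8, h9, h10, h13, h14, h15⟩ := hs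
  refine (Halts.sampleEnergy hin (out := 11) (by norm_num) .first (hT .first)).seq ?_
  rintro s1 ⟨n1, r1, e1, d1⟩
  have hin1 : HasInput ν μ ε s1 := hin.congr (n1 0 (by norm_num) (by norm_num))
    fun a ha => r1 a (by omega) (by omega)
  refine (Halts.sampleEnergy hin1 (out := 12) (by norm_num) .second (hT .second)).seq ?_
  rintro s2 ⟨n2, r2, e2, d2⟩
  have hin2 : HasInput ν μ ε s2 := hin1.congr (n2 0 (by norm_num) (by norm_num))
    fun a ha => r2 a (by omega) (by omega)
  have r : ∀ a, a ≠ 7 → a ≠ 11 → a ≠ 12 → s2.real a = s.real a := fun a h h' h'' =>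
    (r2 a h h'').trans (r1 a h h')
  have v11 : s2.real 11 0 0 = energyFirst O δ ω i := by
    rw [r2 11 (by norm_num) (by norm_num), e1, hd]; rfl
  have v12 : s2.real 12 0 0 = energySecond O δ ω i := by
    rw [e2, d1, hd, show 2 + 2 * i + 1 = 3 + 2 * i by ring]; rfl
  have v8 : s2.real 8 0 0 = O.count .first δ (ω 0).1 := by
    rw [r 8 (by norm_num) (by norm_num) (by norm_num), h8]
  have v9 : s2.real 9 0 0 = O.count .second δ (ω 1).1 := by
    rw [r 9 (by norm_num) (by norm_num) (by norm_num), h9]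
  have v3 : s2.nat 3 = i := by
    rw [n2 3 (by norm_num) (by norm_num), n1 3 (by norm_num) (by norm_num), h3]
  have l11 : (logRatioExp 11).eval s2 = energyFirst O δ ω i - logZEstimate O δ ω := by
    simp only [logRatioExp, RExp.eval, RExp.var, NExp.eval, v11, v8, v9, logZEstimate]; ring
  have l12 : (logRatioExp 12).eval s2 = energySecond O δ ω i - logZEstimate O δ ω := by
    simp only [logRatioExp, RExp.eval, RExp.var, NExp.eval, v12, v8, v9, logZEstimate]; ring
  refine Halts.seq (Halts.addTo (Q := fun s3 => s3 = _) rfl) ?_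
  rintro s3 hs3
  refine Halts.seq (Halts.addTo (Q := fun s4 => s4 = _) rfl) ?_
  rintro s4 hs4
  refine Halts.seq (Halts.addTo (Q := fun s5 => s5 = _) rfl) ?_
  rintro s5 hs5
  have r3 : ∀ a, a ≠ 13 → s3.real a = s2.real a := fun a ha => by
    rw [hs3]; exact s2.setR_real_of_ne 0 0 _ ha
  have r4 : ∀ a, a ≠ 14 → s4.real a = s3.real a := fun a ha => by
    rw [hs4]; exact s3.setR_real_of_ne 0 0 _ ha
  have r5 : ∀ a, a ≠ 15 → s5.real a = s4.real a := fun a ha => by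
    rw [hs5]; exact s4.setR_real_of_ne 0 0 _ ha
  have n5 : s5.nat = s2.nat := by rw [hs5, hs4, hs3]; rfl
  have d5 : s5.draws = s2.draws := by rw [hs5, hs4, hs3]; rfl
  have rr : ∀ a, a ≠ 13 → a ≠ 14 → a ≠ 15 → s5.real a = s2.real a := fun a h h' h'' =>
    (r5 a h'').trans ((r4 a h').trans (r3 a h))
  refine Halts.setN ⟨hin2.congr ?_ ?_, ?_, ?_, ?_, ?_, ?_, ?_, ?_, ?_⟩
  · simp [State.setN, n5]
  · exact fun a ha => rr a (by omega) (by omega) (by omega)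
  · simp [State.setN, NExp.eval, n5, v3]
  · change s5.draws = _
    rw [d5, d2, d1, hd]; ring
  · change s5.real 8 0 0 = _
    rw [rr 8 (by norm_num) (by norm_num) (by norm_num), v8]
  · change s5.real 9 0 0 = _
    rw [rr 9 (by norm_num) (by norm_num) (by norm_num), v9]
  · change s5.real 10 0 0 = _
    rw [rr 10 (by norm_num) (by norm_num) (by norm_num),
      r 10 (by norm_num) (by norm_num) (by norm_num), h10]
  · change s5.real 13 0 0 = _
    rw [r5 13 (by norm_num), r4 13 (by norm_num), hs3, State.setR_real_self,
      r 13 (by norm_num) (by norm_num) (by norm_num), h13, directSum, directSum,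
      Finset.sum_range_succ]
    simp only [RExp.eval, ha, hc, l11, l12]
  · change s5.real 14 0 0 = _
    rw [r5 14 (by norm_num), hs4, State.setR_real_self, r3 14 (by norm_num),
      r 14 (by norm_num) (by norm_num) (by norm_num), h14, Finset.sum_range_succ]
    simp only [RExp.eval, RExp.var, NExp.eval, r3 12 (by norm_num), v12]
  · change s5.real 15 0 0 = _
    rw [hs5, State.setR_real_self, r4 15 (by norm_num), r3 15 (by norm_num),
      r 15 (by norm_num) (by norm_num) (by norm_num), h15, Finset.sum_range_succ]
    simp only [RExp.eval_npow, RExp.eval, RExp.var, NExp.eval, r4 12 (by norm_num),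
      r3 12 (by norm_num), v12]

/-- The number of draws. -/
noncomputable def drawNumber (K n : ℕ) (ε : ℝ) : ℕ := ⌈40 * invAccuracy K n (1 + 1 / ε) ^ 2⌉₊

open Classical in
/-- The output of the program on the random source `ω`. -/
noncomputable def estimate (O : Oracles ν μ P) (a c : ℝ → ℝ) (K k : ℕ) (ε : ℝ)
    (ω : ℕ → Ξ × Bool) : ℝ :=
  if 2 * ((n : ℝ) + 1) ^ 2 * (IsingModel.diff ν μ).normSq * (300 * (1 + 1 / ε)) ^ 2 < 1 then
    ((∑ i ∈ Finset.range (drawNumber K n ε),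
        energySecond O (oracleError K n ε) ω i ^ 2) / drawNumber K n ε
      - ((∑ i ∈ Finset.range (drawNumber K n ε),
        energySecond O (oracleError K n ε) ω i) / drawNumber K n ε) ^ 2) / k
  else directSum O a c (oracleError K n ε) ω (drawNumber K n ε) / drawNumber K n ε

/-- The running time of the program, if each oracle call takes time at most `T` and `N` samples are
drawn from each model. -/
def programCost (K k : ℕ) (aE cE : RExp → RExp) (n : ℕ) (N T : ℝ) : ℝ :=
  (1 + (oracleErrorExp K).size + T) + ((1 + (oracleErrorExp K).size + T)
    + (doubleSumCost normTerm.size n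
      + ((N * (1 + (drawTest K).size + drawCost K aE cE n T) + (1 + (drawTest K).size))
        + (1 + closeTest.size + (3 + (varianceExp k).size + (averageExp 13).size)))))

/-- The program halts within a time bound that does not depend on the random source, and its output
is the explicit function `estimate` of the random source. -/
theorem halts_divergenceProgram (ha : ∀ s e, (aE e).eval s = a (e.eval s))
    (hc : ∀ s e, (cE e).eval s = c (e.eval s))
    (hT : ∀ w, O.sampleCost w (oracleError K n ε) ≤ T ∧ O.countCost w (oracleError K n ε) ≤ T) :
    Halts O ω (divergenceProgram K k aE cE) (inputState ν μ ε)
      (programCost K k aE cE n (drawNumber K n ε) T)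
      fun s => s.output = estimate O a c K k ε ω := by
  set δ := oracleError K n ε with hδ
  set s0 := inputState ν μ ε with hs0
  have hin0 : HasInput ν μ ε s0 := ⟨by simp [hs0, inputState], fun _ _ => rfl⟩
  have z0 : ∀ a, 6 ≤ a → s0.real a 0 0 = 0 := fun a ha => by
    simp [hs0, inputState, show a ≠ 0 by omega, show a ≠ 1 by omega, show a ≠ 2 by omega,
      show a ≠ 3 by omega, show a ≠ 4 by omega, show a ≠ 5 by omega]
  refine Halts.seq (Q := fun s1 => s1 = (s0.setR 8 0 0 (O.count .first δ (ω 0).1)).draw)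
    ⟨_, _, .count s0 .first (oracleErrorExp K) 8, ?_, ?_⟩ ?_
  · rw [hin0.eval_oracleError]; gcongr; exact (hT .first).2
  · rw [hin0.eval_oracleError]; rfl
  intro s1 hs1
  have r1 : ∀ a, a ≠ 8 → s1.real a = s0.real a := fun a ha => by
    rw [hs1]; exact s0.setR_real_of_ne 0 0 _ ha
  have v1 : s1.real 8 0 0 = O.count .first δ (ω 0).1 := by
    rw [hs1]; exact s0.setR_real_self 8 0 0 _
  have n1 : s1.nat = s0.nat := by rw [hs1]; rfl
  have d1 : s1.draws = 1 := by rw [hs1]; rfl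
  have hin1 : HasInput ν μ ε s1 := hin0.congr (by rw [n1]) fun a ha => r1 a (by omega)
  refine Halts.seq (Q := fun s2 => s2 = (s1.setR 9 0 0 (O.count .second δ (ω 1).1)).draw)
    ⟨_, _, .count s1 .second (oracleErrorExp K) 9, ?_, ?_⟩ ?_
  · rw [hin1.eval_oracleError]; gcongr; exact (hT .second).2
  · rw [hin1.eval_oracleError, d1]; rfl
  intro s2 hs2
  have r2 : ∀ a, a ≠ 9 → s2.real a = s1.real a := fun a ha => by
    rw [hs2]; exact s1.setR_real_of_ne 0 0 _ ha
  have v2 : s2.real 9 0 0 = O.count .second δ (ω 1).1 := by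
    rw [hs2]; exact s1.setR_real_self 9 0 0 _
  have n2 : s2.nat = s0.nat := by rw [hs2]; exact n1
  have d2 : s2.draws = 2 := by
    rw [hs2]; change s1.draws + 1 = 2; rw [d1]
  have hin2 : HasInput ν μ ε s2 := hin1.congr (by rw [n1, n2]) fun a ha => r2 a (by omega)
  refine (Halts.norm hin2).seq ?_
  rintro s3 ⟨n3, r3, v3, d3⟩
  refine Halts.seq (Q := DrawInv O ω ε a c δ (drawNumber K n ε))
    (Halts.loop (Inv := DrawInv O ω ε a c δ) (T := drawCost K aE cE n T) ?_ ?_ ?_) ?_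
  · intro i hi s hs
    refine ⟨?_, Halts.drawStep ha hc hs fun w => (hT w).1⟩
    simp only [drawTest, BExp.eval, RExp.eval, RExp.eval_npow, NExp.eval, hs.1.eval_invAccuracy,
      hs.2.1, Int.cast_ofNat]
    exact Nat.lt_ceil.1 hi
  · intro s hs
    simp only [drawTest, BExp.eval, RExp.eval, RExp.eval_npow, NExp.eval, hs.1.eval_invAccuracy,
      hs.2.1, not_lt, Int.cast_ofNat]
    exact Nat.le_ceil _
  · have r : ∀ a, a ≠ 8 → a ≠ 9 → a ≠ 10 → s3.real a = s0.real a := fun a h h' h'' =>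
      (r3 a h'').trans ((r2 a h').trans (r1 a h))
    refine ⟨hin2.congr (n3 0 (by norm_num) (by norm_num)) fun a ha => r3 a (by omega), ?_, ?_, ?_,
      ?_, v3, ?_, ?_, ?_⟩
    · rw [n3 3 (by norm_num) (by norm_num), n2, hs0]; simp [inputState]
    · rw [d3, d2]
    · rw [r3 8 (by norm_num), r2 8 (by norm_num), v1]
    · rw [r3 9 (by norm_num), v2]
    · rw [r 13 (by norm_num) (by norm_num) (by norm_num), z0 13 (by norm_num)]; simp [directSum]
    · rw [r 14 (by norm_num) (by norm_num) (by norm_num), z0 14 (by norm_num)]; simp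
    · rw [r 15 (by norm_num) (by norm_num) (by norm_num), z0 15 (by norm_num)]; simp
  · rintro s ⟨hin, h3, hd, h8, h9, h10, h13, h14, h15⟩
    have htest : closeTest.eval s ↔
        2 * ((n : ℝ) + 1) ^ 2 * (IsingModel.diff ν μ).normSq * (300 * (1 + 1 / ε)) ^ 2 < 1 := by
      simp only [closeTest, BExp.eval, RExp.eval, RExp.eval_npow, RExp.var, NExp.eval,
        hin.eval_size, hin.eval_invError, h10]
      push_cast; rfl
    refine Halts.ite (fun ht => ?_) fun ht => ?_
    · refine (Halts.setR ?_).mono ?_ fun _ h => h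
      · rw [htest] at ht
        simp only [State.output, NExp.eval, State.setR_real_self, estimate, if_pos ht]
        simp [varianceExp, averageExp, RExp.eval, RExp.eval_npow, RExp.var, NExp.eval, h14, h15,
          h3, ← hδ]
      · simp only [NExp.size]; push_cast
        have : (0 : ℝ) ≤ (averageExp 13).size := Nat.cast_nonneg _
        linarith
    · refine (Halts.setR ?_).mono ?_ fun _ h => h
      · rw [htest] at ht
        simp only [State.output, NExp.eval, State.setR_real_self, estimate, if_neg ht]
        simp [averageExp, RExp.eval, RExp.var, NExp.eval, h13, h3, ← hδ]
      · simp only [NExp.size]; push_cast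
        have : (0 : ℝ) ≤ (varianceExp k).size := Nat.cast_nonneg _
        linarith

end Execution

end IsingDiv

namespace IsingDiv

set_option linter.unusedSectionVars false

open MeasureTheory

/-! ### Correctness of the estimate -/

lemma invAccuracy_ge_one {K n : ℕ} {E : ℝ} (hK : 1 ≤ K) (hE : 1 ≤ E) :
    1 ≤ invAccuracy K n E := by
  have hK' : (1 : ℝ) ≤ K := by exact_mod_cast hK
  have hn : (0 : ℝ) ≤ n := Nat.cast_nonneg n
  have h1 : (1 : ℝ) ≤ 1382400000 * (K : ℝ) ^ 3 :=
    one_le_mul_of_one_le_of_one_le (by norm_num) (one_le_pow₀ hK')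
  exact one_le_mul_of_one_le_of_one_le
    (one_le_mul_of_one_le_of_one_le h1 (one_le_pow₀ (by linarith))) (one_le_pow₀ hE)

section Correctness

variable {n : ℕ} {G : SimpleGraph (Fin n)} {ν μ : IsingModel G} {Ξ : Type}
    [MeasurableSpace Ξ] {P : Measure Ξ} [IsProbabilityMeasure P] {O : Oracles ν μ P}
    {ε b : ℝ} {K k : ℕ} {f a c : ℝ → ℝ}

/-- Replacing the estimated normalization by the true one changes the direct estimator by at most
`4 * δ`. -/
lemma abs_directSum_div_sub_le (hf : IsLogGenerator f a c k) {δ : ℝ} {ω : ℕ → Ξ × Bool} {N : ℕ}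
    (hN : 0 < N) (h₁ : |Real.log (O.countFirst.out δ (ω 0).1) - Real.log ν.Z| ≤ δ)
    (h₂ : |Real.log (O.countSecond.out δ (ω 1).1) - Real.log μ.Z| ≤ δ) :
    |directSum O a c δ ω N / N
      - ((∑ i ∈ Finset.range N, a (IsingModel.logRatio ν μ
          (O.sampleFirst.out δ (ω (2 + 2 * i)).1))) / N
        + (∑ i ∈ Finset.range N, c (IsingModel.logRatio ν μ
          (O.sampleSecond.out δ (ω (3 + 2 * i)).1))) / N)| ≤ 4 * δ := by
  have hN' : (0 : ℝ) < N := by exact_mod_cast hN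
  set z := logZEstimate O δ ω with hz
  have hzz : |Real.log ν.Z - Real.log μ.Z - z| ≤ 2 * δ := by
    have e : Real.log ν.Z - Real.log μ.Z - z
        = (Real.log (O.countSecond.out δ (ω 1).1) - Real.log μ.Z)
          - (Real.log (O.countFirst.out δ (ω 0).1) - Real.log ν.Z) := by
      simp only [hz, logZEstimate, Oracles.count]; ring
    rw [e]
    exact (abs_sub _ _).trans (by linarith)
  rw [← add_div, ← sub_div, abs_div, abs_of_pos hN', div_le_iff₀ hN', directSum,
    ← Finset.sum_add_distrib, ← Finset.sum_sub_distrib]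
  refine (Finset.abs_sum_le_sum_abs _ _).trans ((Finset.sum_le_card_nsmul _ _ (4 * δ) ?_).trans
    (le_of_eq (by simp; ring)))
  intro i _
  have ha := hf.a_lip (energyFirst O δ ω i - z)
    (IsingModel.logRatio ν μ (O.sampleFirst.out δ (ω (2 + 2 * i)).1))
  have hc := hf.c_lip (energySecond O δ ω i - z)
    (IsingModel.logRatio ν μ (O.sampleSecond.out δ (ω (3 + 2 * i)).1))
  have e1 : energyFirst O δ ω i - z
      - IsingModel.logRatio ν μ (O.sampleFirst.out δ (ω (2 + 2 * i)).1)
      = Real.log ν.Z - Real.log μ.Z - z := by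
    simp only [energyFirst, IsingModel.logRatio, Oracles.sample]; ring
  have e2 : energySecond O δ ω i - z
      - IsingModel.logRatio ν μ (O.sampleSecond.out δ (ω (3 + 2 * i)).1)
      = Real.log ν.Z - Real.log μ.Z - z := by
    simp only [energySecond, IsingModel.logRatio, Oracles.sample]; ring
  rw [e1] at ha
  rw [e2] at hc
  rw [add_sub_add_comm]
  exact (abs_add_le _ _).trans (by linarith)

/-- If the parameters agree, then the divergence and the estimate are exactly `0`; this includes the
graph without vertices. -/
lemma measure_estimate_of_normSq_eq_zero (hf : IsLogGenerator f a c k)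
    (hQ : (IsingModel.diff ν μ).normSq = 0) :
    sourceLaw P {ω | ¬ (Real.exp (-ε) * ν.fDiv μ f ≤ estimate O a c K k ε ω ∧
      estimate O a c K k ε ω ≤ Real.exp ε * ν.fDiv μ f)} ≤ 1 / 3 := by
  have he : ∀ σ, (IsingModel.diff ν μ).energy σ = 0 := fun σ => by
    have := (IsingModel.diff ν μ).energy_sq_le σ
    rw [hQ, mul_zero] at this
    exact pow_eq_zero_iff two_ne_zero |>.1 (le_antisymm this (sq_nonneg _))
  have hD : ν.fDiv μ f = 0 := IsingModel.fDiv_eq_zero_of_energy hf he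
  have hest : ∀ ω, estimate O a c K k ε ω = 0 := fun ω => by
    rw [estimate, if_pos (by rw [hQ]; norm_num)]
    simp [energySecond, he]
  simp [hD, hest]

lemma measure_estimate_of_close (hf : IsLogGenerator f a c k) (hε : 0 < ε) [NeZero n]
    (hμ : μ.FlipBounded b) (hb : 0 < b) (hK : 1 / b ≤ K)
    (hQ : 0 < (IsingModel.diff ν μ).normSq)
    (hclose : 2 * ((n : ℝ) + 1) ^ 2 * (IsingModel.diff ν μ).normSq * (300 * (1 + 1 / ε)) ^ 2 < 1) :
    sourceLaw P {ω | ¬ (Real.exp (-ε) * ν.fDiv μ f ≤ estimate O a c K k ε ω ∧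
      estimate O a c K k ε ω ≤ Real.exp ε * ν.fDiv μ f)} ≤ 1 / 3 := by
  set D := IsingModel.diff ν μ with hD
  have hE : 1 ≤ 1 + 1 / ε := le_add_of_nonneg_right (by positivity)
  have hK1 : 1 ≤ K := Nat.one_le_iff_ne_zero.2 fun h => by
    have := (one_div_pos.2 hb).trans_le hK
    simp [h] at this
  set W := invAccuracy K n (1 + 1 / ε) with hW
  have hW0 : 0 < W := by linarith [invAccuracy_ge_one (n := n) hK1 hE]
  set B := Real.sqrt (2 * ((n : ℝ) + 1) ^ 2 * D.normSq) with hB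
  have hB0 : 0 < B := Real.sqrt_pos.2 (by positivity)
  have hB2 : B ^ 2 = 2 * ((n : ℝ) + 1) ^ 2 * D.normSq := Real.sq_sqrt (by positivity)
  have hDB2 : ∀ σ, D.energy σ ^ 2 ≤ B ^ 2 := fun σ => by
    refine (D.energy_sq_le σ).trans ?_
    rw [hB2, Fintype.card_fin]
    gcongr
    linarith
  have hN : 40 * W ^ 2 ≤ drawNumber K n ε := Nat.le_ceil _
  have m₁ := O.sampleSecond.measure_empirical_mean_le (ι := fun i => 3 + 2 * i)
    (fun i j h => by simpa using h) hB0 (g := D.energy)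
    (fun σ => abs_le_of_sq_le_sq (hDB2 σ) hB0.le) hW0 hN
  have m₂ := O.sampleSecond.measure_empirical_mean_le (ι := fun i => 3 + 2 * i)
    (fun i j h => by simpa using h) (show 0 < B ^ 2 by positivity) (g := fun σ => D.energy σ ^ 2)
    (fun σ => by rw [abs_of_nonneg (sq_nonneg _)]; exact hDB2 σ) hW0 hN
  refine (measure_mono ?_).trans ((measure_union_le _ _).trans
    ((add_le_add m₁ m₂).trans ?_))
  · intro ω hω
    by_contra hgood
    simp only [Set.mem_union, not_or, Set.mem_ofPred_eq, not_not] at hgood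
    refine hω (exp_bounds_of_abs_sub_le hε (IsingModel.fDiv_nonneg hf) ?_)
    rw [estimate, if_pos hclose]
    exact IsingModel.abs_moment_estimate_sub_fDiv_le hf hμ hb hK hE (Fintype.card_fin n)
      hB0.le hB2 (by rw [hB2]; exact hclose) hgood.1 hgood.2
  · rw [← ENNReal.ofReal_add (by norm_num) (by norm_num)]
    refine ENNReal.ofReal_le_of_le_toReal ?_
    norm_num

lemma measure_estimate_of_far (hf : IsLogGenerator f a c k) (hε : 0 < ε) [NeZero n]
    (hν : ν.FlipBounded b) (hμ : μ.FlipBounded b) (hb : 0 < b) (hK : 1 / b ≤ K)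
    (hfar : ¬ 2 * ((n : ℝ) + 1) ^ 2 * (IsingModel.diff ν μ).normSq
      * (300 * (1 + 1 / ε)) ^ 2 < 1) :
    sourceLaw P {ω | ¬ (Real.exp (-ε) * ν.fDiv μ f ≤ estimate O a c K k ε ω ∧
      estimate O a c K k ε ω ≤ Real.exp ε * ν.fDiv μ f)} ≤ 1 / 3 := by
  have hE : 1 ≤ 1 + 1 / ε := le_add_of_nonneg_right (by positivity)
  have hK1 : 1 ≤ K := Nat.one_le_iff_ne_zero.2 fun h => by
    have := (one_div_pos.2 hb).trans_le hK
    simp [h] at this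
  have hK0 : (0 : ℝ) < K := by exact_mod_cast hK1
  set W := invAccuracy K n (1 + 1 / ε) with hW
  have hW0 : 0 < W := by linarith [invAccuracy_ge_one (n := n) hK1 hE]
  set B := ((n : ℝ) + 1) ^ 2 * K with hB
  have hB0 : 0 < B := by positivity
  have hl : ∀ σ, |IsingModel.logRatio ν μ σ| ≤ B := fun σ =>
    IsingModel.abs_logRatio_le_of_flipBounded hν hμ hb hK (Fintype.card_fin n) σ
  have hN : 40 * W ^ 2 ≤ drawNumber K n ε := Nat.le_ceil _
  have hN0 : 0 < drawNumber K n ε := Nat.ceil_pos.2 (by positivity)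
  have m₁ := O.sampleFirst.measure_empirical_mean_le (ι := fun i => 2 + 2 * i)
    (fun i j h => by simpa using h) hB0 (g := fun σ => a (IsingModel.logRatio ν μ σ))
    (fun σ => by
      have := hf.a_lip (IsingModel.logRatio ν μ σ) 0
      rw [hf.a_zero, sub_zero, sub_zero] at this
      exact this.trans (hl σ)) hW0 hN
  have m₂ := O.sampleSecond.measure_empirical_mean_le (ι := fun i => 3 + 2 * i)
    (fun i j h => by simpa using h) hB0 (g := fun σ => c (IsingModel.logRatio ν μ σ))
    (fun σ => by
      have := hf.c_lip (IsingModel.logRatio ν μ σ) 0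
      rw [hf.c_zero, sub_zero, sub_zero] at this
      exact this.trans (hl σ)) hW0 hN
  have hδ : 0 < 1 / (4 * W) := by positivity
  have m₃ := O.countFirst.measure_log_le hδ 0
  have m₄ := O.countSecond.measure_log_le hδ 1
  refine (measure_mono ?_).trans ((measure_union_le _ _).trans
    ((add_le_add ((measure_union_le _ _).trans (add_le_add m₁ m₂))
      ((measure_union_le _ _).trans (add_le_add m₃ m₄))).trans ?_))
  · intro ω hω
    by_contra hgood
    simp only [Set.mem_union, not_or, Set.mem_ofPred_eq, not_not] at hgood
    obtain ⟨⟨g₁, g₂⟩, g₃, g₄⟩ := hgood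
    refine hω (exp_bounds_of_abs_sub_le hε (IsingModel.fDiv_nonneg hf) ?_)
    rw [estimate, if_neg hfar]
    refine IsingModel.abs_direct_estimate_sub_fDiv_le hf hμ hb hK hE (Fintype.card_fin n)
      (not_lt.1 hfar) g₁ g₂ ?_
    refine (abs_directSum_div_sub_le hf hN0 g₃ g₄).trans (le_of_eq ?_)
    rw [← hW]
    field_simp
  · rw [← ENNReal.ofReal_add (by norm_num) (by norm_num),
      ← ENNReal.ofReal_add (by norm_num) (by norm_num),
      ← ENNReal.ofReal_add (by norm_num) (by norm_num)]
    refine ENNReal.ofReal_le_of_le_toReal ?_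
    norm_num

/-- The estimate has the required accuracy with probability at least `2 / 3`. -/
theorem measure_estimate (hf : IsLogGenerator f a c k) (hε : 0 < ε)
    (hν : ν.FlipBounded b) (hμ : μ.FlipBounded b) (hb : 0 < b) (hK : 1 / b ≤ K) :
    sourceLaw P {ω | ¬ (Real.exp (-ε) * ν.fDiv μ f ≤ estimate O a c K k ε ω ∧
      estimate O a c K k ε ω ≤ Real.exp ε * ν.fDiv μ f)} ≤ 1 / 3 := by
  rcases (IsingModel.normSq_nonneg (IsingModel.diff ν μ)).eq_or_lt with hQ | hQ
  · exact measure_estimate_of_normSq_eq_zero hf hQ.symm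
  have : NeZero n := ⟨by rintro rfl; simp [IsingModel.normSq] at hQ⟩
  by_cases h : 2 * ((n : ℝ) + 1) ^ 2 * (IsingModel.diff ν μ).normSq * (300 * (1 + 1 / ε)) ^ 2 < 1
  · exact measure_estimate_of_close hf hε hμ hb hK hQ h
  · exact measure_estimate_of_far hf hε hν hμ hb hK h

end Correctness

/-! ### The running time is polynomial -/

lemma eval_aeval_mvPolynomial (p : Polynomial ℝ) (y : MvPolynomial (Fin 2) ℝ) (v : Fin 2 → ℝ) :
    MvPolynomial.eval v (Polynomial.aeval y p) = p.eval (MvPolynomial.eval v y) := by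
  have : (MvPolynomial.eval v).comp (algebraMap ℝ (MvPolynomial (Fin 2) ℝ)) = RingHom.id ℝ := by
    ext x; simp
  rw [Polynomial.aeval_def, Polynomial.hom_eval₂, this, Polynomial.eval]

/-- The time bound as a polynomial in `n` and `1 / ε`. The number of samples is less than
`40 * W ^ 2 + 1`, and `n` divided by the error bound of the oracle calls is `n * (4 * W)`. -/
lemma exists_polynomial_programCost (K k : ℕ) (aE cE : RExp → RExp) (p : Polynomial ℝ) :
    ∃ q : MvPolynomial (Fin 2) ℝ, ∀ (n : ℕ) (ε : ℝ), MvPolynomial.eval ![(n : ℝ), 1 / ε] q =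
      programCost K k aE cE n (40 * invAccuracy K n (1 + 1 / ε) ^ 2 + 1)
        (p.eval (n * (4 * invAccuracy K n (1 + 1 / ε)))) := by
  open MvPolynomial in
  let w : MvPolynomial (Fin 2) ℝ := C (1382400000 * (K : ℝ) ^ 3) * (X 0 + 1) ^ 8 * (1 + X 1) ^ 3
  let t : MvPolynomial (Fin 2) ℝ := Polynomial.aeval (X 0 * (C 4 * w)) p
  let ds : ℕ → MvPolynomial (Fin 2) ℝ := fun z => X 0 * (X 0 * C ((z : ℝ) + 15) + C 14) + C 10
  let call : MvPolynomial (Fin 2) ℝ := C (1 + ((oracleErrorExp K).size : ℝ)) + t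
  let body : MvPolynomial (Fin 2) ℝ := C (1 + ((drawTest K).size : ℝ)) +
    ((call + ds energyTerm.size) + ((call + ds energyTerm.size) + C (
      (((RExp.add (aE (logRatioExp 11)) (cE (logRatioExp 12))).size + 7)
        + (((RExp.var 12).size + 7)
          + ((((RExp.var 12).npow 2).size + 7)
            + (1 + (NExp.add (.reg 3) (.lit 1)).size))) : ℝ))))
  refine ⟨call + (call + (ds normTerm.size + (((C 40 * w ^ 2 + 1) * body
    + C (1 + ((drawTest K).size : ℝ))) + C (1 + (closeTest.size : ℝ)
      + (3 + ((varianceExp k).size : ℝ) + ((averageExp 13).size : ℝ)))))), fun n ε => ?_⟩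
  have hw : eval ![(n : ℝ), 1 / ε] w = invAccuracy K n (1 + 1 / ε) := by
    simp only [w, map_mul, map_add, map_pow, map_one, eval_C, eval_X, invAccuracy,
      Matrix.cons_val_zero, Matrix.cons_val_one]
  have ht : eval ![(n : ℝ), 1 / ε] t = p.eval (n * (4 * invAccuracy K n (1 + 1 / ε))) := by
    simp only [t, eval_aeval_mvPolynomial, map_mul, eval_C, eval_X, hw, Matrix.cons_val_zero]
  have hds : ∀ z, eval ![(n : ℝ), 1 / ε] (ds z) = doubleSumCost z n := fun z => by
    simp only [ds, map_mul, map_add, eval_C, eval_X, doubleSumCost, Matrix.cons_val_zero]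
  simp only [body, call, map_mul, map_add, map_pow, map_one, eval_C, hw, ht, hds, programCost,
    drawCost, add_assoc]

lemma programCost_mono {K k : ℕ} {aE cE : RExp → RExp} {n : ℕ} {N N' T : ℝ} (hT : 0 ≤ T)
    (hN : N ≤ N') : programCost K k aE cE n N T ≤ programCost K k aE cE n N' T := by
  have hd : 0 ≤ 1 + ((drawTest K).size : ℝ) + drawCost K aE cE n T := by
    unfold drawCost doubleSumCost
    positivity
  unfold programCost
  gcongr

/-- The program is an approximation scheme for every divergence with a generator as in
`IsLogGenerator` whose two parts can be computed. -/
theorem isFPRAS_divergenceProgram {f a c : ℝ → ℝ} {k : ℕ} (hf : IsLogGenerator f a c k)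
    {aE cE : RExp → RExp} (ha : ∀ s e, (aE e).eval s = a (e.eval s))
    (hc : ∀ s e, (cE e).eval s = c (e.eval s)) {b : ℝ} (hb : 0 < b) :
    IsFPRAS (divergenceProgram ⌈1 / b⌉₊ k aE cE) f b := by
  set K := ⌈1 / b⌉₊ with hKdef
  have hK : 1 / b ≤ K := Nat.le_ceil _
  have hK1 : 1 ≤ K := Nat.one_le_iff_ne_zero.2 (Nat.ceil_pos.2 (one_div_pos.2 hb)).ne'
  intro p
  obtain ⟨q, hq⟩ := exists_polynomial_programCost K k aE cE p
  refine ⟨q, fun n G ν μ hν hμ Ξ _ P _ O hO ε hε => ?_⟩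
  have hE : 1 ≤ 1 + 1 / ε := le_add_of_nonneg_right (by positivity)
  set W := invAccuracy K n (1 + 1 / ε) with hW
  have hW1 : 1 ≤ W := invAccuracy_ge_one hK1 hE
  have hδ : 0 < oracleError K n ε := by unfold oracleError; rw [← hW]; positivity
  have hδ1 : oracleError K n ε < 1 := by
    unfold oracleError; rw [← hW, div_lt_one (by positivity)]; linarith
  have hdiv : (Nat.card (Fin n) : ℝ) / oracleError K n ε = n * (4 * W) := by
    rw [Nat.card_fin, oracleError, ← hW, div_div_eq_mul_div, div_one]
  have hT : ∀ w, O.sampleCost w (oracleError K n ε) ≤ p.eval (n * (4 * W)) ∧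
      O.countCost w (oracleError K n ε) ≤ p.eval (n * (4 * W)) := fun w => by
    rw [← hdiv]
    exact ⟨(hO w).1 _ hδ hδ1, (hO w).2 _ hδ hδ1⟩
  have hT0 : 0 ≤ p.eval (n * (4 * W)) := by
    refine le_trans ?_ (hT .first).1
    exact le_trans (by positivity) (O.sampleFirst.isCost.ge_size _ hδ)
  have hrun := fun ω : ℕ → Ξ × Bool =>
    halts_divergenceProgram (O := O) (ω := ω) (k := k) ha hc hT
  refine ⟨fun ω => ?_, ?_⟩
  · obtain ⟨t, s, h1, h2, -⟩ := hrun ω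
    refine ⟨t, s, h1, h2.trans ?_⟩
    rw [hq]
    exact programCost_mono hT0 (Nat.ceil_lt_add_one (by positivity)).le
  · refine (measure_mono fun ω hω => ?_).trans
      (measure_estimate (O := O) (K := K) hf hε hν.flipBounded hμ.flipBounded hb hK)
    refine fun hgood => hω ?_
    obtain ⟨t, s, h1, -, h3⟩ := hrun ω
    refine ⟨t, s, h1, ?_⟩
    rw [h3]
    exact hgood

end IsingDiv

theorem mainTheorem4 (b : ℝ) (hb : 0 < b) :
    (∃ M : IsingDiv.Cmd, IsingDiv.IsFPRAS M IsingDiv.klGen b) ∧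
    (∃ M : IsingDiv.Cmd, IsingDiv.IsFPRAS M IsingDiv.renyiGen b) ∧
    (∃ M : IsingDiv.Cmd, IsingDiv.IsFPRAS M IsingDiv.jsGen b) := by
  refine ⟨⟨_, IsingDiv.isFPRAS_divergenceProgram IsingDiv.isLogGenerator_klGen
      (aE := fun e => e) (cE := fun _ => .lit 0) (fun s e => rfl) (fun s e => ?_) hb⟩,
    ⟨_, IsingDiv.isFPRAS_divergenceProgram IsingDiv.isLogGenerator_renyiGen
      (aE := fun _ => .lit 0) (cE := fun e => .sub (.lit 0) e) (fun s e => ?_) (fun s e => ?_) hb⟩,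
    ⟨_, IsingDiv.isFPRAS_divergenceProgram IsingDiv.isLogGenerator_jsGen
      (aE := fun e => .div (.add e (.sub (.log (.lit 2)) (.log (.add (.lit 1) (.exp e)))))
        (.lit 2))
      (cE := fun e => .div (.sub (.log (.lit 2)) (.log (.add (.lit 1) (.exp e)))) (.lit 2))
      (fun s e => ?_) (fun s e => ?_) hb⟩⟩ <;>
    simp [IsingDiv.RExp.eval]
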